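/- Setting. Work in a bundle coordinate chart of a graded Lagrangian system: independent variables $x^\lambda$ ($\lambda=1,\dots,n$), even and odd fields $s^A$ of Grassmann parity $[A]$ (the coordinates $(x^\lambda,s^A)_{[A]=0}$ range over an arbitrary open set), antifields $\bar s_A$ of parity $[A]+1$, and, for $0\le k\le N$, finitely many $k$-stage ghosts $c^{r_k}$ and $k$-stage antifields $\bar c_{r_k}$ with $[\bar c_{r_k}]=[c^{r_k}]+1$; by convention $r_{-1}=A$, $c^{r_{-1}}=s^A$ and $\bar c_{r_{-1}}=\bar s_A$. Let $P$ be the graded commutative algebra of polynomials in the jets $v_\Lambda$ of the odd variables $v$ whose coefficients are smooth functions of $x^\lambda$ and of finitely many jets of the even variables ($\Lambda$ runs over symmetric multi-indices), and let $S\subset P$ be the subalgebra of functions of $x^\lambda$ and the jets $s^A_\Lambda$ only. Let $d_\lambda=\partial_\lambda+\sum_{v,\Lambda}v_{\lambda+\Lambda}\partial_v^\Lambda$ be the total derivatives, $\omega=dx^1\wedge\dots\wedge dx^n$, $\omega_\lambda=\partial_\lambda\rfloor\omega$, $d_H(\sum_\lambda\sigma^\lambda\omega_\lambda)=\sum_\lambda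 d_\lambda\sigma^\lambda\,\omega$, $\delta_v f=\sum_\Lambda(-1)^{|\Lambda|}d_\Lambda(\partial_v^\Lambda f)$ the (left) variational derivative, and, for a finite tuple $f=(f^\Lambda)$, $$\eta(f)^\Lambda=\sum_\Sigma(-1)^{|\Sigma+\Lambda|}\frac{(\Sigma+\Lambda)!}{\Sigma!\,\Lambda!}\,d_\Sigma f^{\Sigma+\Lambda}.$$ Let $L=\mathcal L\omega$ be an even Lagrangian with $\mathcal L\in S$, let $\mathcal E_A=\delta_{s^A}\mathcal L$, and let $\bar\delta$ be the right graded derivation of $P$ with $\bar\delta\bar s_{\Lambda A}=d_\Lambda\mathcal E_A$ that annihilates $x^\lambda$ and the jets of all other variables. Let $\Delta_{r_k}^{r_{k-1},\Lambda}\in S$ ($0\le k\le N$) and $h_{r_k}^{(r_{k-2},\Sigma)(A,\Xi)}\in S$ ($1\le k\le N$) be finite families of homogeneous functions of parities $[c^{r_k}]+[c^{r_{k-1}}]+1$ and $[c^{r_k}]+[c^{r_{k-2}}]+[A]$, respectively. They are the coefficients of the operators $\Delta_{r_k}=\sum\Delta_{r_k}^{r_{k-1},\Lambda}\bar c_{\Lambda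 r_{k-1}}+\sum h_{r_k}^{(r_{k-2},\Sigma)(A,\Xi)}\bar c_{\Sigma r_{k-2}}\bar s_{\Xi A}+\cdots$, where the second sum is present for $k\ge1$. Put $$u^{r_{k-1}}=\sum_{r_k,\Lambda}c^{r_k}_\Lambda\,\eta(\Delta_{r_k}^{r_{k-1}})^\Lambda .$$ For $k\ge2$ put $\hat h_{r_k}=h_{r_k}$; for $k=1$ put $\hat h_{r_1}^{(B,\Sigma)(A,\Xi)}=h_{r_1}^{(B,\Sigma)(A,\Xi)}+(-1)^{[\bar s_A][\bar s_B]}h_{r_1}^{(A,\Xi)(B,\Sigma)}$. Put $$\alpha^{r_{k-2}}=-\sum_{r_k,A,\Xi,\Sigma}(-1)^{\epsilon}\,\eta\bigl(\hat h_{r_k}^{(r_{k-2})(A,\Xi)}\bigr)^\Sigma d_\Sigma\bigl(c^{r_k}\bar s_{\Xi A}\bigr),\qquad \epsilon=\bigl([c^{r_k}]+[c^{r_{k-2}}]+[A]\bigr)[c^{r_k}]+[\bar c_{r_{k-2}}][A].$$ Theorem. Let $1\le k\le N$, and suppose that the $k$-stage gauge symmetry condition $$\sum_{r_{k-1},\Sigma}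 d_\Sigma u^{r_{k-1}}\,\partial^\Sigma_{r_{k-1}}u^{r_{k-2}}=\bar\delta(\alpha^{r_{k-2}})\qquad\text{for all } r_{k-2}$$ holds. Then: (i) the density $$\mathcal D_k\,\omega=\Bigl[\sum c^{r_k}\hat h_{r_k}^{(r_{k-2},\Sigma)(A,\Xi)}\bar c_{\Sigma r_{k-2}}d_\Xi\mathcal E_A+\sum u^{r_{k-1}}\Delta_{r_{k-1}}^{r_{k-2},\Xi}\bar c_{\Xi r_{k-2}}\Bigr]\omega$$ is $d_H$-exact, $\mathcal D_k\,\omega=d_H\sigma'_k$; (ii) for every $r_k$, the variational derivative of this equality with respect to the ghost $c^{r_k}$ is the equality $\delta_{c^{r_k}}\mathcal D_k=0$, where $$\delta_{c^{r_k}}\mathcal D_k=\sum_{r_{k-1},\Lambda}\Delta_{r_k}^{r_{k-1},\Lambda}d_\Lambda\Bigl(\sum_{r_{k-2},\Sigma}\Delta_{r_{k-1}}^{r_{k-2},\Sigma}\bar c_{\Sigma r_{k-2}}\Bigr)+\bar\delta\Bigl(\sum h_{r_k}^{(r_{k-2},\Sigma)(A,\Xi)}\bar c_{\Sigma r_{k-2}}\bar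 s_{\Xi A}\Bigr);$$ (iii) consequently, the $k$-stage Noether identities hold for all $r_k$: $$\sum_{r_{k-1},\Lambda}\Delta_{r_k}^{r_{k-1},\Lambda}d_\Lambda\Bigl(\sum_{r_{k-2},\Sigma}\Delta_{r_{k-1}}^{r_{k-2},\Sigma}\bar c_{\Sigma r_{k-2}}\Bigr)=-\bar\delta\Bigl(\sum h_{r_k}^{(r_{k-2},\Sigma)(A,\Xi)}\bar c_{\Sigma r_{k-2}}\bar s_{\Xi A}\Bigr).$$ -/

import Mathlib

open scoped TensorProduct ContDiff

noncomputable section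

/-! ## Smooth functions of finitely many coordinates -/

namespace JetFun

open Classical in
/-- `f` is, on the open set `D` of the (possibly infinite-dimensional) coordinate space `C → ℝ`
with its product topology, a smooth function of finitely many of the coordinates. -/
def IsFinSmooth {C : Type} (D : TopologicalSpace.Opens (C → ℝ)) (f : D → ℝ) : Prop :=
  ∃ (S : Finset C) (g : (S → ℝ) → ℝ),
    ContDiffOn ℝ ∞ g ((fun z : C → ℝ => fun i : S => z i) '' (D : Set (C → ℝ))) ∧
      ∀ z : D, f z = g (fun i : S => (z : C → ℝ) i)

variable {C : Type} {D : TopologicalSpace.Opens (C → ℝ)}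

theorem IsFinSmooth.mono {f : D → ℝ} {S : Finset C} {g : (S → ℝ) → ℝ}
    (hg : ContDiffOn ℝ ∞ g ((fun z : C → ℝ => fun i : S => z i) '' (D : Set (C → ℝ))))
    (hf : ∀ z : D, f z = g (fun i : S => (z : C → ℝ) i)) {T : Finset C} (h : S ⊆ T) :
    ∃ g' : (T → ℝ) → ℝ,
      ContDiffOn ℝ ∞ g' ((fun z : C → ℝ => fun i : T => z i) '' (D : Set (C → ℝ))) ∧
        ∀ z : D, f z = g' (fun i : T => (z : C → ℝ) i) := by
  refine ⟨fun w => g (fun i : S => w ⟨i, h i.2⟩), ?_, fun z => hf z⟩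
  refine hg.comp (g := g) (f := fun w : T → ℝ => fun i : S => w ⟨i, h i.2⟩) ?_ ?_
  · exact ContDiff.contDiffOn (contDiff_pi.2 fun i => contDiff_apply ℝ ℝ _)
  · rintro _ ⟨z, hz, rfl⟩
    exact ⟨z, hz, rfl⟩

theorem IsFinSmooth.pair {f₁ f₂ : D → ℝ} (h₁ : IsFinSmooth D f₁) (h₂ : IsFinSmooth D f₂) :
    ∃ (S : Finset C) (g₁ g₂ : (S → ℝ) → ℝ),
      (ContDiffOn ℝ ∞ g₁ ((fun z : C → ℝ => fun i : S => z i) '' (D : Set (C → ℝ))) ∧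
        ∀ z : D, f₁ z = g₁ (fun i : S => (z : C → ℝ) i)) ∧
      (ContDiffOn ℝ ∞ g₂ ((fun z : C → ℝ => fun i : S => z i) '' (D : Set (C → ℝ))) ∧
        ∀ z : D, f₂ z = g₂ (fun i : S => (z : C → ℝ) i)) := by
  classical
  obtain ⟨S, g, hg, hf⟩ := h₁
  obtain ⟨S', g', hg', hf'⟩ := h₂
  obtain ⟨k, hk⟩ := IsFinSmooth.mono hg hf (Finset.subset_union_left (s₁ := S) (s₂ := S'))
  obtain ⟨k', hk'⟩ := IsFinSmooth.mono hg' hf' (Finset.subset_union_right (s₁ := S) (s₂ := S'))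
  exact ⟨_, k, k', hk, hk'⟩

variable (D) in
/-- The commutative real algebra of smooth functions of finitely many coordinates on `D`. -/
def smoothAlg : Subalgebra ℝ (D → ℝ) where
  carrier := {f | IsFinSmooth D f}
  mul_mem' := by
    intro a b ha hb
    obtain ⟨S, g, g', ⟨h1, h2⟩, h3, h4⟩ := IsFinSmooth.pair ha hb
    exact ⟨S, fun w => g w * g' w, h1.mul h3, fun z => by simp [h2, h4]⟩
  add_mem' := by
    intro a b ha hb
    obtain ⟨S, g, g', ⟨h1, h2⟩, h3, h4⟩ := IsFinSmooth.pair ha hb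
    exact ⟨S, fun w => g w + g' w, h1.add h3, fun z => by simp [h2, h4]⟩
  algebraMap_mem' := by
    intro r
    exact ⟨∅, fun _ => r, contDiffOn_const, fun z => rfl⟩

variable (D) in
/-- The coordinate function `c`. -/
def coord (c : C) : smoothAlg D :=
  ⟨fun z => (z : C → ℝ) c, {c}, fun w => w ⟨c, by simp⟩,
    (contDiff_apply ℝ ℝ _).contDiffOn, fun _ => rfl⟩

open Classical in
/-- The function of one real variable obtained from `f` by moving the coordinate `c` of `z`
(and `0` where this leaves `D`). -/
def alongLine (f : D → ℝ) (c : C) (z : D) (t : ℝ) : ℝ :=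
  if h : Function.update (z : C → ℝ) c t ∈ D then f ⟨_, h⟩ else 0

theorem isOpen_image (S : Finset C) :
    IsOpen ((fun z : C → ℝ => fun i : S => z i) '' (D : Set (C → ℝ))) := by
  classical
  rw [isOpen_iff_mem_nhds]
  rintro _ ⟨z, hz, rfl⟩
  let e : (S → ℝ) → (C → ℝ) := fun w c => if h : c ∈ S then w ⟨c, h⟩ else z c
  have he : Continuous e := by
    refine continuous_pi fun c => ?_
    by_cases h : c ∈ S
    · simpa [e, h] using continuous_apply _
    · simpa [e, h] using continuous_const
  have hz' : e (fun i : S => z i) = z := by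
    funext c
    by_cases h : c ∈ S <;> simp [e, h]
  refine Filter.mem_of_superset
    ((D.isOpen.preimage he).mem_nhds (by simpa [hz'] using hz)) ?_
  intro w hw
  exact ⟨e w, hw, by funext i; simp [e]⟩

theorem hasDerivAt_alongLine {f : D → ℝ} {S : Finset C} {g : (S → ℝ) → ℝ}
    (hg : ContDiffOn ℝ ∞ g ((fun z : C → ℝ => fun i : S => z i) '' (D : Set (C → ℝ))))
    (hf : ∀ z : D, f z = g (fun i : S => (z : C → ℝ) i)) (c : C) (z : D) :
    HasDerivAt (alongLine f c z)
      (fderiv ℝ g (fun i : S => (z : C → ℝ) i)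
        (fun i : S => (open Classical in if (i : C) = c then 1 else 0))) ((z : C → ℝ) c) := by
  classical
  have hd : DifferentiableAt ℝ g (fun i : S => (z : C → ℝ) i) :=
    (hg.contDiffAt ((isOpen_image S).mem_nhds ⟨z, z.2, rfl⟩)).differentiableAt (by simp)
  have hu : Continuous fun t : ℝ => Function.update (z : C → ℝ) c t :=
    continuous_const.update c continuous_id
  have hev : ∀ᶠ t in nhds ((z : C → ℝ) c),
      alongLine f c z t = g (fun i : S => Function.update (z : C → ℝ) c t i) := by
    filter_upwards [(D.isOpen.preimage hu).mem_nhds (by simp)] with t ht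
    have ht' : Function.update (z : C → ℝ) c t ∈ D := ht
    simp only [alongLine, ht', dif_pos]
    exact hf ⟨_, ht'⟩
  refine HasDerivAt.congr_of_eventuallyEq ?_ hev
  have hl : HasDerivAt (fun t : ℝ => fun i : S => Function.update (z : C → ℝ) c t i)
      (fun i : S => if (i : C) = c then 1 else 0) ((z : C → ℝ) c) := by
    refine hasDerivAt_pi.2 fun i => ?_
    by_cases h : (i : C) = c
    · simpa [h] using hasDerivAt_id' _
    · simpa [h] using hasDerivAt_const _ _
  have hz : (fun i : S => Function.update (z : C → ℝ) c ((z : C → ℝ) c) i)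
      = fun i : S => (z : C → ℝ) i := by simp
  exact HasFDerivAt.comp_hasDerivAt ((z : C → ℝ) c) (by rw [hz]; exact hd.hasFDerivAt) hl

theorem isFinSmooth_deriv {f : D → ℝ} (hf : IsFinSmooth D f) (c : C) :
    IsFinSmooth D fun z => deriv (alongLine f c z) ((z : C → ℝ) c) := by
  classical
  obtain ⟨S, g, hg, h⟩ := hf
  refine ⟨S, fun w => fderiv ℝ g w (fun i : S => if (i : C) = c then 1 else 0), ?_, fun z => ?_⟩
  · exact (hg.fderiv_of_isOpen (isOpen_image S) (by simp)).clm_apply contDiffOn_const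
  · convert (hasDerivAt_alongLine hg h c z).deriv

theorem differentiableAt_alongLine {f : D → ℝ} (hf : IsFinSmooth D f) (c : C) (z : D) :
    DifferentiableAt ℝ (alongLine f c z) ((z : C → ℝ) c) := by
  obtain ⟨S, g, hg, h⟩ := hf
  exact (hasDerivAt_alongLine hg h c z).differentiableAt

variable (D) in
/-- The partial derivative with respect to the coordinate `c`. -/
def pd (c : C) : smoothAlg D →ₗ[ℝ] smoothAlg D where
  toFun f := ⟨fun z => deriv (alongLine f.1 c z) ((z : C → ℝ) c), isFinSmooth_deriv f.2 c⟩
  map_add' a b := by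
    refine Subtype.ext (funext fun z => ?_)
    have : alongLine (a + b).1 c z = alongLine a.1 c z + alongLine b.1 c z := by
      funext t
      by_cases h : Function.update (z : C → ℝ) c t ∈ D <;> simp [alongLine, h]
    change deriv (alongLine (a + b).1 c z) _ = deriv _ _ + deriv _ _
    rw [this]
    exact deriv_add (differentiableAt_alongLine a.2 c z) (differentiableAt_alongLine b.2 c z)
  map_smul' r a := by
    refine Subtype.ext (funext fun z => ?_)
    have : alongLine (r • a).1 c z = fun t => r * alongLine a.1 c z t := by
      funext t
      by_cases h : Function.update (z : C → ℝ) c t ∈ D <;> simp [alongLine, h]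
    change deriv (alongLine (r • a).1 c z) _ = r * deriv _ _
    rw [this]
    exact deriv_const_mul_field _

end JetFun

/-! ## Local graded functions on infinite order jets -/

/-- Symmetric multi-indices `Λ` in `n` variables; `Λ l` is the number of occurrences of `l`. -/
abbrev MultiIdx (n : ℕ) : Type := Fin n →₀ ℕ

/-- The length `|Λ|`. -/
def MultiIdx.len {n : ℕ} (Λ : MultiIdx n) : ℕ := ∑ l, Λ l

/-- The factor `(Σ + Λ)! / (Σ! Λ!)`, a product of binomial coefficients over the variables. -/
def MultiIdx.binom {n : ℕ} (S Λ : MultiIdx n) : ℕ := ∏ l, (S l + Λ l).choose (Λ l)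

/-- The sign `(-1)^e` of a Grassmann parity `e`. -/
def gsign (e : ZMod 2) : ℝ := if e = 0 then 1 else -1

/-- A coordinate chart of a graded field theory with `n` independent variables and with ghosts and
antifields up to stage `N`.

`R 0` indexes the fields `s^A` (the even ones are the fibre coordinates of `Y`, the odd ones the
generators of the Grassmann algebra), and `R (k + 1)` indexes the `k`-stage ghosts `c^{r_k}` and
antifields. `par j r` is the Grassmann parity of the field, or ghost. `dom` is the range of the
bundle coordinates `(x, y)` of `Y`. -/
structure FieldChart where
  n : ℕ
  N : ℕ
  R : ℕ → Type
  [fintypeR : ∀ j, Fintype (R j)]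
  isEmptyR : ∀ j, N + 1 < j → IsEmpty (R j)
  par : (j : ℕ) → R j → ZMod 2
  dom : TopologicalSpace.Opens ((Fin n → ℝ) × ({A : R 0 // par 0 A = 0} → ℝ))

attribute [instance] FieldChart.fintypeR

namespace FieldChart

variable (M : FieldChart)

/-- The local generating basis: `field 0 A` is `s^A`, `field (k + 1) r` is the ghost `c^{r_k}`,
`anti 0 A` is the antifield of `s^A`, and `anti (k + 1) r` is the `k`-stage antifield. -/
inductive Gen : Type
  | field (j : ℕ) (r : M.R j)
  | anti (j : ℕ) (r : M.R j)

variable {M} in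
/-- Grassmann parity of the generators; a field and its antifield have opposite parities. -/
def Gen.parity : M.Gen → ZMod 2
  | .field j r => M.par j r
  | .anti j r => M.par j r + 1

/-- Jets `(v, Λ)` of generators. -/
abbrev Jet : Type := M.Gen × MultiIdx M.n

/-- The real coordinates: the `x^l`, and the jets of even generators. -/
abbrev Coord : Type := Fin M.n ⊕ {j : M.Jet // j.1.parity = 0}

/-- The odd variables: the jets of odd generators. -/
abbrev OddJet : Type := {j : M.Jet // j.1.parity ≠ 0}

/-- The bundle coordinates `(x, y)` of a point of the infinite order jet chart. -/
def baseProj (z : M.Coord → ℝ) : (Fin M.n → ℝ) × ({A : M.R 0 // M.par 0 A = 0} → ℝ) :=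
  (fun l => z (.inl l), fun A => z (.inr ⟨(.field 0 A.1, 0), A.2⟩))

theorem continuous_baseProj : Continuous M.baseProj :=
  (continuous_pi fun _ => continuous_apply _).prodMk (continuous_pi fun _ => continuous_apply _)

/-- The chart of the infinite order jet manifold over `dom`. -/
def jetDom : TopologicalSpace.Opens (M.Coord → ℝ) :=
  ⟨M.baseProj ⁻¹' M.dom, M.dom.isOpen.preimage M.continuous_baseProj⟩

/-- Smooth functions of finitely many of the `x^l` and of the jets of even generators. -/
abbrev Body : Type := JetFun.smoothAlg M.jetDom

/-- The Grassmann algebra generated by the jets of odd generators. -/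
abbrev Grass : Type := ExteriorAlgebra ℝ (M.OddJet →₀ ℝ)

/-- The graded commutative algebra of graded functions on the chart: polynomials in the odd
variables whose coefficients are smooth functions of finitely many even variables. -/
abbrev Alg : Type := M.Body ⊗[ℝ] M.Grass

variable {M}

open Classical in
/-- The jet variable `v_Λ` as a graded function. -/
def jet (v : M.Gen) (Λ : MultiIdx M.n) : M.Alg :=
  if h : v.parity = 0 then JetFun.coord M.jetDom (.inr ⟨(v, Λ), h⟩) ⊗ₜ 1
  else 1 ⊗ₜ ExteriorAlgebra.ι ℝ (Finsupp.single (⟨(v, Λ), h⟩ : M.OddJet) 1)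

/-- The derivative `∂_l` with respect to the explicit dependence on `x^l`. -/
def xderiv (l : Fin M.n) : M.Alg →ₗ[ℝ] M.Alg :=
  TensorProduct.map (JetFun.pd M.jetDom (.inl l)) LinearMap.id

open Classical in
/-- The (left) graded partial derivative with respect to `v_Λ`. -/
def lderiv (v : M.Gen) (Λ : MultiIdx M.n) : M.Alg →ₗ[ℝ] M.Alg :=
  if h : v.parity = 0 then
    TensorProduct.map (JetFun.pd M.jetDom (.inr ⟨(v, Λ), h⟩)) LinearMap.id
  else TensorProduct.map LinearMap.id
    (CliffordAlgebra.contractLeft (Finsupp.lapply (⟨(v, Λ), h⟩ : M.OddJet)))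

open Classical in
/-- The right graded partial derivative with respect to `v_Λ`. -/
def rderiv (v : M.Gen) (Λ : MultiIdx M.n) : M.Alg →ₗ[ℝ] M.Alg :=
  if h : v.parity = 0 then
    TensorProduct.map (JetFun.pd M.jetDom (.inr ⟨(v, Λ), h⟩)) LinearMap.id
  else TensorProduct.map LinearMap.id
    (CliffordAlgebra.contractRight.flip (Finsupp.lapply (⟨(v, Λ), h⟩ : M.OddJet)))

/-- `f` is homogeneous of Grassmann parity `e`: the grade involution acts on it as `(-1)^e`. -/
def HasParity (f : M.Alg) (e : ZMod 2) : Prop :=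
  TensorProduct.map (LinearMap.id : M.Body →ₗ[ℝ] M.Body)
    (CliffordAlgebra.involute (Q := (0 : QuadraticForm ℝ (M.OddJet →₀ ℝ)))).toLinearMap f
      = gsign e • f

variable (M) in
/-- The coordinates `x^l` and `s^A_Λ`, `s^A` even. -/
def fieldCoords : Set M.Coord :=
  {c | (∃ l, c = .inl l) ∨ ∃ A Λ h, c = .inr ⟨(.field 0 A, Λ), h⟩}

variable (M) in
/-- The subalgebra of graded functions of the original fields: it is generated by the smooth
functions of the `x^l` and the even `s^A_Λ`, and by the odd `s^A_Λ`. -/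
def fieldAlg : Subalgebra ℝ M.Alg :=
  Algebra.adjoin ℝ
    ({f | ∃ g : M.Body,
        (∀ z w : M.jetDom, (∀ c ∈ M.fieldCoords, (z : M.Coord → ℝ) c = (w : M.Coord → ℝ) c) →
          g.1 z = g.1 w) ∧ f = g ⊗ₜ 1}
      ∪ {f | ∃ A Λ, M.par 0 A ≠ 0 ∧ f = jet (.field 0 A) Λ})

/-- The total derivative `d_l = ∂_l + ∑ v_{l+Λ} ∂_v^Λ`, the sum being over all jets. -/
def dtot (l : Fin M.n) (f : M.Alg) : M.Alg :=
  xderiv l f + ∑ᶠ j : M.Jet, jet j.1 (j.2 + Finsupp.single l 1) * lderiv j.1 j.2 f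

/-- The iterated total derivative `d_Λ`. -/
def dmul (Λ : MultiIdx M.n) (f : M.Alg) : M.Alg :=
  (List.finRange M.n).foldr (fun l g => (dtot l)^[Λ l] g) f

/-- The (left) variational derivative with respect to the generator `v`,
`∑ (-1)^{|Λ|} d_Λ (∂_v^Λ f)`. -/
def varDeriv (v : M.Gen) (f : M.Alg) : M.Alg :=
  ∑ᶠ Λ : MultiIdx M.n, (-1 : ℝ) ^ Λ.len • dmul Λ (lderiv v Λ f)

/-- The graded density `f ω` is `d_H`-exact, i.e. equals
`d_H (∑ σ^l ω_l) = ∑ d_l σ^l ω` for some graded functions `σ^l`. -/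
def IsHExact (f : M.Alg) : Prop :=
  ∃ σ : Fin M.n → M.Alg, f = ∑ l, dtot l (σ l)

/-- `η(f)^Λ = ∑_Σ (-1)^{|Σ+Λ|} (Σ+Λ)!/(Σ! Λ!) d_Σ f^{Σ+Λ}`. -/
def eta (f : MultiIdx M.n → M.Alg) (Λ : MultiIdx M.n) : M.Alg :=
  ∑ᶠ S : MultiIdx M.n, ((-1 : ℝ) ^ (S + Λ).len * (S.binom Λ : ℝ)) • dmul S (f (S + Λ))

end FieldChart

/-! ## Noether identities and gauge symmetries -/

/-- A graded Lagrangian with the coefficients of a hierarchy of Noether operators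

`Δ_{r_k} = ∑ Δ_{r_k}^{r_{k-1},Λ} c̄_{Λ r_{k-1}} + ∑ h_{r_k}^{(r_{k-2},Σ)(A,Ξ)} c̄_{Σ r_{k-2}} s̄_{Ξ A} + …`

(the index `-1` stands for the `s̄_A`). Here `Δ k r r' Λ` is `Δ_{r_k}^{r_{k-1},Λ}` with `r = r_k`,
`r' = r_{k-1}`, and `h k r r' A S X` is `h_{r_{k+1}}^{(r_{k-1},S)(A,X)}` with `r = r_{k+1}`,
`r' = r_{k-1}`. No identity between them is assumed. -/
structure NoetherData (M : FieldChart) where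
  L : M.Alg
  L_mem : L ∈ M.fieldAlg
  L_par : FieldChart.HasParity L 0
  Δ : (k : ℕ) → M.R (k + 1) → M.R k → MultiIdx M.n → M.Alg
  Δ_mem : ∀ k r r' Λ, Δ k r r' Λ ∈ M.fieldAlg
  Δ_par : ∀ k r r' Λ, FieldChart.HasParity (Δ k r r' Λ) (M.par (k + 1) r + M.par k r' + 1)
  Δ_fin : ∀ k r r', (Function.support (Δ k r r')).Finite
  h : (k : ℕ) → M.R (k + 2) → M.R k → M.R 0 → MultiIdx M.n → MultiIdx M.n → M.Alg
  h_mem : ∀ k r r' A S X, h k r r' A S X ∈ M.fieldAlg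
  h_par : ∀ k r r' A S X,
    FieldChart.HasParity (h k r r' A S X) (M.par (k + 2) r + M.par k r' + M.par 0 A)
  h_fin : ∀ k r r' A,
    (Function.support fun q : MultiIdx M.n × MultiIdx M.n => h k r r' A q.1 q.2).Finite

namespace NoetherData

open FieldChart

variable {M : FieldChart} (D : NoetherData M)

/-- The variational derivatives `𝓔_A` of the Lagrangian. -/
def EL (A : M.R 0) : M.Alg := varDeriv (.field 0 A) D.L

/-- The right graded derivation which takes `s̄_{Λ A}` to `d_Λ 𝓔_A` and annihilates the functions
of all other variables. -/
def deltaBar (f : M.Alg) : M.Alg :=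
  ∑ A : M.R 0, ∑ᶠ Λ : MultiIdx M.n, rderiv (.anti 0 A) Λ f * dmul Λ (D.EL A)

/-- The linear part `∑ Δ_{r_k}^{r_{k-1},Λ} c̄_{Λ r_{k-1}}` of the Noether operator `Δ_{r_k}`. -/
def linPart (k : ℕ) (r : M.R (k + 1)) : M.Alg :=
  ∑ r' : M.R k, ∑ᶠ Λ : MultiIdx M.n, D.Δ k r r' Λ * jet (.anti k r') Λ

/-- The term `∑ h_{r_{k+1}}^{(r_{k-1},Σ)(A,Ξ)} c̄_{Σ r_{k-1}} s̄_{Ξ A}` of `Δ_{r_{k+1}}`. -/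
def quadPart (k : ℕ) (r : M.R (k + 2)) : M.Alg :=
  ∑ r' : M.R k, ∑ A : M.R 0, ∑ᶠ S : MultiIdx M.n, ∑ᶠ X : MultiIdx M.n,
    D.h k r r' A S X * jet (.anti k r') S * jet (.anti 0 A) X

/-- The components `u^{r_{k-1}} = ∑ c^{r_k}_Λ η(Δ_{r_k}^{r_{k-1}})^Λ` of the `k`-stage gauge
symmetry (for `k = 0`, of the gauge symmetry `u^A`). -/
def u (k : ℕ) (r' : M.R k) : M.Alg :=
  ∑ r : M.R (k + 1), ∑ᶠ Λ : MultiIdx M.n, jet (.field (k + 1) r) Λ * eta (D.Δ k r r') Λ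

/-- The coefficient of `c̄_{S r_{k-1}}` in the right derivative of `quadPart` along `s̄_{X A}`.
It is `h` itself, unless the antifields `c̄_{r_{k-1}}` are the `s̄_B`: then both factors of
`h^{(B,S)(A,X)} s̄_{S B} s̄_{X A}` contribute, and it is the graded symmetrization of `h`. -/
def hsym : (k : ℕ) → M.R (k + 2) → M.R k → M.R 0 → MultiIdx M.n → MultiIdx M.n → M.Alg
  | 0, r, B, A, S, X =>
      D.h 0 r B A S X + gsign ((M.par 0 A + 1) * (M.par 0 B + 1)) • D.h 0 r A B X S
  | k + 1, r, r', A, S, X => D.h (k + 1) r r' A S X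

/-- `α^{r_{k-1}} = - ∑ ± η(h_{r_{k+1}}^{(r_{k-1})(A,Ξ)})^Σ d_Σ (c^{r_{k+1}} s̄_{Ξ A})`; the sign is
the one of the permutation of `c^{r_{k+1}}` with `h` and of `c̄_{r_{k-1}}` with `𝓔_A`. -/
def alpha (k : ℕ) (r' : M.R k) : M.Alg :=
  - ∑ r : M.R (k + 2), ∑ A : M.R 0, ∑ᶠ X : MultiIdx M.n, ∑ᶠ S : MultiIdx M.n,
      gsign ((M.par (k + 2) r + M.par k r' + M.par 0 A) * M.par (k + 2) r
          + (M.par k r' + 1) * M.par 0 A) •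
        (eta (fun S' => D.hsym k r r' A S' X) S *
          dmul S (jet (.field (k + 2) r) 0 * jet (.anti 0 A) X))

/-- The gauge symmetry condition of stage `k + 1`:
`∑ d_Σ u^{r_k} ∂_{r_k}^Σ u^{r_{k-1}} = δ̄ (α^{r_{k-1}})` for all `r_{k-1}`. -/
def GaugeCondition (k : ℕ) : Prop :=
  ∀ r' : M.R k,
    (∑ r : M.R (k + 1), ∑ᶠ S : MultiIdx M.n,
        dmul S (D.u (k + 1) r) * lderiv (.field (k + 1) r) S (D.u k r'))
      = D.deltaBar (D.alpha k r')

/-- The graded function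
`∑ c^{r_{k+1}} h_{r_{k+1}}^{(r_{k-1},Σ)(A,Ξ)} c̄_{Σ r_{k-1}} d_Ξ 𝓔_A
  + u^{r_k} ∑ Δ_{r_k}^{r_{k-1},Ξ} c̄_{Ξ r_{k-1}}`. -/
def symDensity (k : ℕ) : M.Alg :=
  (∑ r : M.R (k + 2), ∑ r' : M.R k, ∑ A : M.R 0, ∑ᶠ X : MultiIdx M.n, ∑ᶠ S : MultiIdx M.n,
      jet (.field (k + 2) r) 0 * D.hsym k r r' A S X * jet (.anti k r') S * dmul X (D.EL A))
    + ∑ r : M.R (k + 1), D.u (k + 1) r * D.linPart k r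

/-- The left-hand side `∑ Δ_{r_{k+1}}^{r_k,Λ} d_Λ (∑ Δ_{r_k}^{r_{k-1},Σ} c̄_{Σ r_{k-1}})` of the
Noether identity of stage `k + 1`. -/
def noetherLHS (k : ℕ) (r : M.R (k + 2)) : M.Alg :=
  ∑ r' : M.R (k + 1), ∑ᶠ Λ : MultiIdx M.n, D.Δ (k + 1) r r' Λ * dmul Λ (D.linPart k r')

end NoetherData

end

/-! Densities are compared modulo the image of d_H, where d_S moves from one factor of a product to
the other at the cost of (-1)^|S| (`mk_mul_dmul`). Stripping the derivatives off the antifields c̄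
of stage k-2 in this way turns u Δ c̄ into (∑ d_S u · η(Δ)^S) c̄ (`mk_u_mul_linPart`), because η
computes the coefficients of the formal adjoint operator. The lower gauge symmetry is linear in its
ghosts with exactly these coefficients (`lderiv_u`), so the bracket is the left side of the gauge
condition, that is, δ̄(α). The other term of the density, c ĥ c̄ d𝓔, reduces in the same way to
-δ̄(α) c̄ (`mk_ghost_term`, `deltaBar_alpha`): δ̄ commutes with total derivatives, and the sign in α
is the one created by reordering the factors. The two terms cancel, so the density is exact
(`symDensity_mem_exact`).

A variational derivative annihilates exact densities, since [∂_v^Λ, d_l] = ∂_v^{Λ-l} makes the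
alternating sum telescope (`varDeriv_dtot`). But the density is also linear in the ghosts c of stage
k, so its variational derivative can be computed outright (`varDeriv_symDensity`). From u Δ c̄ it
produces the formal adjoint of η(Δ), and η is an involution (`eta_eta`), which restores Δ d_Λ(…).
The remaining term is c times δ̄ of the quadratic part, because ĥ collects every contribution of δ̄
there (`deltaBar_quadPart`). Equating the two values gives the Noether identity.

All of this uses only the rules gathered in `JetCalculus`: graded commutativity, Leibniz rules,
commutation of derivatives, and finiteness. For the actual algebra they follow from the symmetry of
second derivatives of smooth functions and from contractions being anticommuting odd derivations of
the Grassmann algebra. Signs are carried by the grade involution, so the Leibniz rules hold for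
arbitrary elements, not only homogeneous ones. -/

noncomputable section

/-! ### Partial derivatives of smooth functions of finitely many coordinates. -/

namespace JetFun

variable {C : Type} {D : TopologicalSpace.Opens (C → ℝ)}

theorem pd_apply (c : C) (f : smoothAlg D) (z : D) :
    (pd D c f).1 z = deriv (alongLine f.1 c z) ((z : C → ℝ) c) := rfl

theorem pd_mul (c : C) (a b : smoothAlg D) : pd D c (a * b) = pd D c a * b + a * pd D c b := by
  refine Subtype.ext (funext fun z => ?_)
  have h : alongLine (a * b).1 c z = alongLine a.1 c z * alongLine b.1 c z := by
    funext t
    by_cases h : Function.update (z : C → ℝ) c t ∈ D <;> simp [alongLine, h]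
  have h0 : ∀ f : smoothAlg D, alongLine f.1 c z ((z : C → ℝ) c) = f.1 z := by
    intro f
    simp [alongLine]
  change deriv (alongLine (a * b).1 c z) _ = deriv (alongLine a.1 c z) _ * b.1 z
    + a.1 z * deriv (alongLine b.1 c z) _
  rw [h, deriv_mul (differentiableAt_alongLine a.2 c z) (differentiableAt_alongLine b.2 c z),
    h0, h0]

open Classical in
theorem pd_coord (c c' : C) : pd D c (coord D c') = if c' = c then 1 else 0 := by
  refine Subtype.ext (funext fun z => ?_)
  have h := (hasDerivAt_alongLine (D := D) (f := (coord D c').1) (S := {c'})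
    (g := fun w => w ⟨c', by simp⟩) (contDiff_apply ℝ ℝ _).contDiffOn (fun _ => rfl) c z).deriv
  rw [pd_apply, h]
  have hf : HasFDerivAt (fun w : ({c'} : Finset C) → ℝ => w ⟨c', by simp⟩)
      (ContinuousLinearMap.proj (R := ℝ) (⟨c', by simp⟩ : ({c'} : Finset C)))
      (fun i => (z : C → ℝ) i) := hasFDerivAt_apply _ _
  rw [hf.fderiv]
  by_cases hc : c' = c <;> simp [hc]

/-- Both iterated partial derivatives are values of the second Fréchet derivative of one
finite-dimensional representative `g`, on two basis vectors in either order, and that bilinear form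
is symmetric. -/
theorem pd_comm (c c' : C) (f : smoothAlg D) : pd D c (pd D c' f) = pd D c' (pd D c f) := by
  classical
  obtain ⟨f, S, g, hg, hf⟩ := f
  have key : ∀ (a b : C) (z : D), (pd D a (pd D b ⟨f, S, g, hg, hf⟩)).1 z
      = fderiv ℝ (fderiv ℝ g) (fun i : S => (z : C → ℝ) i)
          (fun i : S => if (i : C) = a then 1 else 0)
          (fun i : S => if (i : C) = b then 1 else 0) := by
    intro a b z
    have h1 : ∀ z : D, (pd D b ⟨f, S, g, hg, hf⟩).1 z
        = (fun w => fderiv ℝ g w (fun i : S => if (i : C) = b then 1 else 0))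
          (fun i : S => (z : C → ℝ) i) := by
      intro z
      rw [pd_apply]
      convert (hasDerivAt_alongLine hg hf b z).deriv
    have hd : ContDiffOn ℝ ∞ (fderiv ℝ g)
        ((fun z : C → ℝ => fun i : S => z i) '' (D : Set (C → ℝ))) :=
      hg.fderiv_of_isOpen (isOpen_image S) (by simp)
    rw [pd_apply]
    have h2 := (hasDerivAt_alongLine (hd.clm_apply contDiffOn_const) h1 a z).deriv
    refine h2.trans ?_
    have hda : DifferentiableAt ℝ (fderiv ℝ g) (fun i : S => (z : C → ℝ) i) :=
      (hd.contDiffAt ((isOpen_image S).mem_nhds ⟨z, z.2, rfl⟩)).differentiableAt (by simp)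
    rw [fderiv_clm_apply hda (differentiableAt_const _)]
    simp
  refine Subtype.ext (funext fun z => ?_)
  rw [key, key]
  have hs : IsSymmSndFDerivAt ℝ g (fun i : S => (z : C → ℝ) i) :=
    (hg.contDiffAt ((isOpen_image S).mem_nhds ⟨z, z.2, rfl⟩)).isSymmSndFDerivAt
      (by simpa using (WithTop.coe_le_coe.2 le_top : ((2 : ℕ∞) : WithTop ℕ∞) ≤ ∞))
  exact hs _ _

theorem pd_eq_zero_of_forall_update (c : C) (f : smoothAlg D)
    (h : ∀ z w : D, (∀ c' ≠ c, (z : C → ℝ) c' = (w : C → ℝ) c') → f.1 z = f.1 w) :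
    pd D c f = 0 := by
  classical
  refine Subtype.ext (funext fun z => ?_)
  rw [pd_apply]
  have hu : Continuous fun t : ℝ => Function.update (z : C → ℝ) c t :=
    continuous_const.update c continuous_id
  have hev : alongLine f.1 c z =ᶠ[nhds ((z : C → ℝ) c)] fun _ => f.1 z := by
    filter_upwards [(D.isOpen.preimage hu).mem_nhds (by simp)] with t ht
    have ht' : Function.update (z : C → ℝ) c t ∈ D := ht
    simp only [alongLine, ht', dif_pos]
    exact h _ _ fun c' hc' => by simp [hc']
  rw [hev.deriv_eq]
  simp

/-- Only coordinates in the finite set of a representative can contribute. This is one half of what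
makes the sum over all jets in a total derivative finite. -/
theorem finite_pd_ne_zero (f : smoothAlg D) : {c | pd D c f ≠ 0}.Finite := by
  classical
  obtain ⟨f, S, g, hg, hf⟩ := f
  refine S.finite_toSet.subset fun c hc => ?_
  by_contra hcS
  refine hc (pd_eq_zero_of_forall_update c _ fun z w hzw => ?_)
  change f z = f w
  rw [hf, hf]
  congr 1
  funext i
  exact hzw _ fun h => hcS (h ▸ i.2)

end JetFun

/-! ### Binomial identities and sums over multi-indices. -/

namespace MultiIdx

variable {n : ℕ}

theorem len_zero : (0 : MultiIdx n).len = 0 := by simp [len]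

theorem len_add (a b : MultiIdx n) : (a + b).len = a.len + b.len := by
  simp [len, Finset.sum_add_distrib]

theorem len_single (l : Fin n) : MultiIdx.len (Finsupp.single l 1) = 1 := by
  classical
  simp [len, Finsupp.single_apply]

theorem binom_comm (a b : MultiIdx n) : a.binom b = b.binom a := by
  refine Finset.prod_congr rfl fun l _ => ?_
  rw [add_comm, Nat.choose_symm_add]

theorem binom_zero_right (a : MultiIdx n) : a.binom 0 = 1 := by simp [binom]

theorem binom_zero_left (a : MultiIdx n) : (0 : MultiIdx n).binom a = 1 := by simp [binom]

/-- In each variable both sides are the multinomial coefficient (x+y+z)!/(x! y! z!), seen after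
multiplying by the denominator. -/
theorem binom_mul_binom (a b c : MultiIdx n) :
    a.binom b * (a + b).binom c = (b + c).binom a * b.binom c := by
  simp only [binom, ← Finset.prod_mul_distrib]
  refine Finset.prod_congr rfl fun l _ => ?_
  simp only [Finsupp.add_apply]
  generalize a l = x, b l = y, c l = z
  have h1 := Nat.add_choose_mul_factorial_mul_factorial x y
  have h2 := Nat.add_choose_mul_factorial_mul_factorial (x + y) z
  have h3 := Nat.add_choose_mul_factorial_mul_factorial (y + z) x
  have h4 := Nat.add_choose_mul_factorial_mul_factorial y z
  have e : y + z + x = x + y + z := by ring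
  rw [e] at h3 ⊢
  have hp : 0 < x.factorial * y.factorial * z.factorial := by positivity
  refine Nat.eq_of_mul_eq_mul_right hp ?_
  calc _ = ((x + y + z).choose z) * ((x + y).choose y * x.factorial * y.factorial)
        * z.factorial := by ring
    _ = (x + y + z).factorial := by rw [h1, h2]
    _ = ((x + y + z).choose x) * ((y + z).choose z * y.factorial * z.factorial)
        * x.factorial := by rw [h4, h3]
    _ = _ := by ring

/-- Pascal's rule in the factor belonging to `l`; the other factors do not change. -/
theorem binom_add_single (a b : MultiIdx n) (l : Fin n) :
    (a + Finsupp.single l 1).binom (b + Finsupp.single l 1)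
      = a.binom (b + Finsupp.single l 1) + (a + Finsupp.single l 1).binom b := by
  classical
  simp only [binom]
  have e : ∀ F : Fin n → ℕ, ∏ i, F i = F l * ∏ i ∈ Finset.univ.erase l, F i :=
    fun F => (Finset.mul_prod_erase _ F (Finset.mem_univ l)).symm
  rw [e, e, e]
  have h : ∀ i ∈ Finset.univ.erase l, (Finsupp.single l 1 : Fin n →₀ ℕ) i = 0 := by
    intro i hi
    rw [Finsupp.single_apply, if_neg]
    exact fun h => Finset.ne_of_mem_erase hi h.symm
  have h1 : ∀ i ∈ Finset.univ.erase l, ∀ c : MultiIdx n, (c + (Finsupp.single l 1 : MultiIdx n)) i = c i :=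
    fun i hi c => by simp [h i hi]
  have h2 : ∏ i ∈ Finset.univ.erase l, (a i + (b + (Finsupp.single l 1 : MultiIdx n)) i).choose
      ((b + (Finsupp.single l 1 : MultiIdx n)) i) = ∏ i ∈ Finset.univ.erase l, (a i + b i).choose (b i) :=
    Finset.prod_congr rfl fun i hi => by rw [h1 i hi]
  have h3 : ∏ i ∈ Finset.univ.erase l, ((a + (Finsupp.single l 1 : MultiIdx n)) i + b i).choose (b i)
      = ∏ i ∈ Finset.univ.erase l, (a i + b i).choose (b i) :=
    Finset.prod_congr rfl fun i hi => by rw [h1 i hi]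
  rw [Finset.prod_congr rfl (g := fun i => (a i + b i).choose (b i))
    fun i hi => by rw [h1 i hi, h1 i hi], h2, h3, ← add_mul]
  congr 1
  simp only [Finsupp.add_apply, Finsupp.single_eq_same]
  rw [show a l + 1 + (b l + 1) = (a l + 1 + b l) + 1 by ring, Nat.choose_succ_succ, add_comm]
  congr 2
  ring

theorem binom_add_single_of_eq_zero (a b : MultiIdx n) (l : Fin n) (ha : a l = 0) :
    a.binom (b + Finsupp.single l 1) = a.binom b := by
  classical
  refine Finset.prod_congr rfl fun i _ => ?_
  by_cases h : i = l
  · subst h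
    simp [ha]
  · simp [Ne.symm h]

theorem exists_eq_add_single {a : MultiIdx n} {l : Fin n} (h : a l ≠ 0) :
    ∃ b : MultiIdx n, a = b + Finsupp.single l 1 := by
  classical
  refine ⟨a - Finsupp.single l 1, Finsupp.ext fun i => ?_⟩
  by_cases hi : i = l
  · subst hi
    simp
    omega
  · simp [Ne.symm hi]

open Classical in
-- Pascal's rule in summed form. It is the induction step both of the Leibniz rule for d_U and of
-- the vanishing of alternating binomial sums.
theorem sum_antidiagonal_add_single {A : Type*} [AddCommMonoid A] (U : MultiIdx n) (l : Fin n)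
    (F : MultiIdx n → MultiIdx n → A) :
    ∑ p ∈ Finset.HasAntidiagonal.antidiagonal (U + Finsupp.single l 1), p.1.binom p.2 • F p.1 p.2
      = ∑ p ∈ Finset.HasAntidiagonal.antidiagonal U, p.1.binom p.2 •
          (F (p.1 + Finsupp.single l 1) p.2 + F p.1 (p.2 + Finsupp.single l 1)) := by
  let e : MultiIdx n := Finsupp.single l 1
  have he : ∀ a : MultiIdx n, (a + e) l ≠ 0 := fun a => by simp [e]
  -- Subtraction of multi-indices is truncated, so a summand of Pascal's rule is set to zero where
  -- its `l`-component has nothing to remove.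
  have hsplit : ∀ p ∈ Finset.HasAntidiagonal.antidiagonal (U + e),
      p.1.binom p.2 • F p.1 p.2 = (if p.1 l = 0 then 0 else (p.1 - e).binom p.2 • F p.1 p.2)
        + (if p.2 l = 0 then 0 else p.1.binom (p.2 - e) • F p.1 p.2) := by
    rintro ⟨a, b⟩ hp
    rw [Finset.HasAntidiagonal.mem_antidiagonal] at hp
    dsimp only at hp ⊢
    by_cases ha : a l = 0
    · by_cases hb : b l = 0
      · exact absurd (by rw [← hp]; simp [ha, hb]) (he U)
      · obtain ⟨b, rfl⟩ := exists_eq_add_single hb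
        rw [if_pos ha, if_neg (he b), zero_add, binom_add_single_of_eq_zero _ _ _ ha,
          add_tsub_cancel_right]
    · obtain ⟨a, rfl⟩ := exists_eq_add_single ha
      rw [if_neg (he a), add_tsub_cancel_right]
      by_cases hb : b l = 0
      · rw [if_pos hb, add_zero, binom_comm, binom_add_single_of_eq_zero _ _ _ hb, binom_comm]
      · obtain ⟨b, rfl⟩ := exists_eq_add_single hb
        rw [if_neg (he b), add_tsub_cancel_right, binom_add_single, add_smul]
  simp only [smul_add]
  rw [Finset.sum_congr rfl hsplit, Finset.sum_add_distrib, Finset.sum_add_distrib]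
  congr 1
  · refine (Finset.sum_of_injOn (fun p => (p.1 + e, p.2)) ?_ ?_ ?_ ?_).symm
    · rintro ⟨a, b⟩ _ ⟨a', b'⟩ _ h
      simpa using h
    · rintro ⟨a, b⟩ h
      simp only [Finset.mem_coe, Finset.HasAntidiagonal.mem_antidiagonal] at h ⊢
      rw [← h]
      abel
    · rintro ⟨a, b⟩ h h'
      refine if_pos (by_contra fun ha => h' ?_)
      obtain ⟨a, rfl⟩ := exists_eq_add_single ha
      refine ⟨(a, b), ?_, rfl⟩
      simp only [Finset.mem_coe, Finset.HasAntidiagonal.mem_antidiagonal] at h ⊢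
      refine add_right_cancel (b := e) ?_
      rw [← h]
      abel
    · rintro ⟨a, b⟩ _
      dsimp only
      rw [if_neg (he a), add_tsub_cancel_right]
  · refine (Finset.sum_of_injOn (fun p => (p.1, p.2 + e)) ?_ ?_ ?_ ?_).symm
    · rintro ⟨a, b⟩ _ ⟨a', b'⟩ _ h
      simpa using h
    · rintro ⟨a, b⟩ h
      simp only [Finset.mem_coe, Finset.HasAntidiagonal.mem_antidiagonal] at h ⊢
      rw [← h]
      abel
    · rintro ⟨a, b⟩ h h'
      refine if_pos (by_contra fun hb => h' ?_)
      obtain ⟨b, rfl⟩ := exists_eq_add_single hb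
      refine ⟨(a, b), ?_, rfl⟩
      simp only [Finset.mem_coe, Finset.HasAntidiagonal.mem_antidiagonal] at h ⊢
      refine add_right_cancel (b := e) ?_
      rw [← h]
      abel
    · rintro ⟨a, b⟩ _
      dsimp only
      rw [if_neg (he b), add_tsub_cancel_right]

theorem induction_add_single {p : MultiIdx n → Prop} (zero : p 0)
    (add : ∀ U l, p U → p (U + Finsupp.single l 1)) (U : MultiIdx n) : p U := by
  classical
  obtain ⟨m, hm⟩ : ∃ m, U.len = m := ⟨_, rfl⟩
  induction m generalizing U with
  | zero =>
    have : U = 0 := Finsupp.ext fun l => by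
      simpa using (Finset.sum_eq_zero_iff.1 hm) l (Finset.mem_univ l)
    exact this ▸ zero
  | succ m ih =>
    obtain ⟨l, hl⟩ : ∃ l, U l ≠ 0 := by
      by_contra! h
      simp [len, h] at hm
    obtain ⟨V, rfl⟩ := exists_eq_add_single hl
    exact add V l (ih V (by rw [len_add, len_single] at hm; omega))

open Classical in
-- This is (1 - 1)^U. For nonzero U, splitting off one index pairs terms whose second entries differ
-- in length by one, and these cancel.
theorem sum_antidiagonal_neg_one_pow (U : MultiIdx n) :
    ∑ p ∈ Finset.HasAntidiagonal.antidiagonal U, p.1.binom p.2 • (-1 : ℝ) ^ p.2.len = if U = 0 then 1 else 0 := by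
  by_cases hU : U = 0
  · subst hU
    simp [len_zero, binom_zero_right]
  · obtain ⟨l, hl⟩ : ∃ l, U l ≠ 0 := by
      by_contra! h
      exact hU (Finsupp.ext h)
    obtain ⟨V, rfl⟩ := exists_eq_add_single hl
    rw [if_neg hU, sum_antidiagonal_add_single V l fun _ b => (-1 : ℝ) ^ b.len]
    refine Finset.sum_eq_zero fun p _ => ?_
    rw [len_add, len_single, pow_succ]
    simp

/-- A double sum is grouped by the value of S + T. Joint finiteness of the support is needed because
a `finsum` with infinite support is zero by convention. -/
theorem finsum_antidiagonal {A : Type*} [AddCommMonoid A] (F : MultiIdx n × MultiIdx n → A)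
    (hF : (Function.support F).Finite) :
    ∑ᶠ U : MultiIdx n, ∑ p ∈ Finset.HasAntidiagonal.antidiagonal U, F p = ∑ᶠ S, ∑ᶠ T, F (S, T) := by
  classical
  rw [← finsum_curry F hF, finsum_eq_sum_of_support_subset F (s := hF.toFinset) (by simp)]
  have hz : ∀ U, ∑ p ∈ Finset.HasAntidiagonal.antidiagonal U, F p
      = ∑ p ∈ hF.toFinset with p.1 + p.2 = U, F p := by
    intro U
    refine (Finset.sum_subset_zero_on_sdiff ?_ ?_ fun _ _ => rfl).symm
    · intro p hp
      exact Finset.HasAntidiagonal.mem_antidiagonal.2 (Finset.mem_filter.1 hp).2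
    · intro p hp
      simp only [Finset.mem_sdiff, Finset.HasAntidiagonal.mem_antidiagonal, Finset.mem_filter,
        Set.Finite.mem_toFinset, Function.mem_support, not_and] at hp
      by_contra h
      exact hp.2 h hp.1
  rw [finsum_congr hz, finsum_eq_sum_of_support_subset (s := hF.toFinset.image fun p => p.1 + p.2)]
  · exact Finset.sum_fiberwise_of_maps_to (fun p hp => Finset.mem_image_of_mem _ hp) F
  · intro U hU
    obtain ⟨p, hp, -⟩ := Finset.exists_ne_zero_of_sum_ne_zero hU
    rw [Finset.mem_filter] at hp
    exact Finset.mem_coe.2 (Finset.mem_image.2 ⟨p, hp⟩)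

end MultiIdx

/-! ### Contractions as odd derivations, and graded commutativity of the exterior algebra. -/

namespace CliffordAlgebra

variable {R V : Type*} [CommRing R] [AddCommGroup V] [Module R V] {Q : QuadraticForm R V}

theorem contractLeft_mul (d : Module.Dual R V) (a b : CliffordAlgebra Q) :
    contractLeft d (a * b) = contractLeft d a * b + involute a * contractLeft d b := by
  induction a using CliffordAlgebra.left_induction with
  | algebraMap r => simp [contractLeft_algebraMap_mul, contractLeft_algebraMap]
  | add x y hx hy => simp only [add_mul, map_add, hx, hy]; abel
  | ι_mul x m hx =>
    rw [mul_assoc, contractLeft_ι_mul, contractLeft_ι_mul, hx, map_mul, involute_ι]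
    simp only [sub_mul, mul_add, smul_mul_assoc, neg_mul, mul_assoc]
    abel

theorem involute_contractLeft (d : Module.Dual R V) (a : CliffordAlgebra Q) :
    involute (contractLeft d a) = - contractLeft d (involute a) := by
  induction a using CliffordAlgebra.left_induction with
  | algebraMap r => simp [contractLeft_algebraMap]
  | add x y hx hy => simp only [map_add, hx, hy, neg_add]
  | ι_mul x m hx =>
    rw [contractLeft_ι_mul, map_mul, involute_ι, neg_mul, map_neg, contractLeft_ι_mul, map_sub,
      map_mul, involute_ι, map_smul, hx]
    simp

/-- On an element of degree p the right and left odd derivatives differ by (-1)^(p-1), which is how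
the involution acts on the derivative. Hence left derivatives suffice throughout. -/
theorem contractRight_eq_involute (d : Module.Dual R V) (a : CliffordAlgebra Q) :
    contractRight a d = involute (contractLeft d a) := by
  induction a using CliffordAlgebra.right_induction with
  | algebraMap r => simp [contractLeft_algebraMap, contractRight_algebraMap]
  | add x y hx hy => simp only [map_add, LinearMap.add_apply, hx, hy]
  | mul_ι m x hx =>
    rw [contractRight_mul_ι, contractLeft_mul, hx, contractLeft_ι, map_add, map_mul, map_mul,
      involute_ι, involute_involute, AlgHom.commutes, ← Algebra.commutes, ← Algebra.smul_def]
    simp only [mul_neg]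
    abel

end CliffordAlgebra

namespace ExteriorAlgebra

open CliffordAlgebra

variable {R V : Type*} [CommRing R] [AddCommGroup V] [Module R V]

/-- Moving a generator through `a` costs one sign per generator of `a`. Graded commutativity in
general follows from this case. -/
theorem ι_mul_eq_involute_mul_ι (m : V) (a : ExteriorAlgebra R V) :
    ι R m * a = involute a * ι R m := by
  induction a using CliffordAlgebra.left_induction with
  | algebraMap r =>
    rw [AlgHom.commutes]
    exact (Algebra.commutes r _).symm
  | add x y hx hy => simp only [mul_add, map_add, add_mul, hx, hy]
  | ι_mul x w hx =>
    have h : ι R m * ι R w = - (ι R w * ι R m) := eq_neg_of_add_eq_zero_left (ι_add_mul_swap m w)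
    change ι R m * (ι R w * x) = involute (ι R w * x) * ι R m
    rw [← mul_assoc, h, map_mul, neg_mul, mul_assoc, hx]
    erw [involute_ι]
    simp [mul_assoc]

theorem mul_comm_of_involute_eq {a : ExteriorAlgebra R V} (ha : involute a = a)
    (b : ExteriorAlgebra R V) : b * a = a * b := by
  induction b using CliffordAlgebra.left_induction with
  | algebraMap r => exact Algebra.commutes r _
  | add x y hx hy => simp only [mul_add, add_mul, hx, hy]
  | ι_mul x m hx =>
    change ι R m * x * a = a * (ι R m * x)
    rw [mul_assoc, hx, ← mul_assoc, ι_mul_eq_involute_mul_ι, ha, mul_assoc]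

theorem mul_comm_of_involute_eq_neg {a : ExteriorAlgebra R V} (ha : involute a = -a)
    (b : ExteriorAlgebra R V) : b * a = a * involute b := by
  induction b using CliffordAlgebra.left_induction with
  | algebraMap r =>
    rw [AlgHom.commutes]
    exact Algebra.commutes r _
  | add x y hx hy => simp only [mul_add, add_mul, map_add, hx, hy]
  | ι_mul x m hx =>
    change ι R m * x * a = a * involute (ι R m * x)
    rw [mul_assoc, hx, ← mul_assoc, ι_mul_eq_involute_mul_ι, ha, map_mul]
    erw [involute_ι]
    simp [mul_assoc]

theorem finite_contractLeft_lapply_ne_zero {X : Type*} (a : ExteriorAlgebra R (X →₀ R)) :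
    {x | contractLeft (Q := (0 : QuadraticForm R (X →₀ R))) (Finsupp.lapply x) a ≠ 0}.Finite := by
  induction a using CliffordAlgebra.left_induction with
  | algebraMap r => simp [contractLeft_algebraMap]
  | add a b ha hb =>
    refine (ha.union hb).subset fun x hx => ?_
    by_contra h
    simp only [Set.mem_union, Set.mem_ofPred_eq, not_or, not_not] at h
    exact hx (by rw [map_add, h.1, h.2, add_zero])
  | ι_mul a m ha =>
    refine (ha.union m.hasFiniteSupport).subset fun x hx => ?_
    by_contra h
    simp only [Set.mem_union, Set.mem_ofPred_eq, not_or, not_not, Function.mem_support] at h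
    exact hx (by rw [contractLeft_ι_mul, h.1]; simp [h.2])

end ExteriorAlgebra

/-! ### Signs, and the calculus on the algebra of graded functions. -/

theorem ZMod.two_cases (p : ZMod 2) : p = 0 ∨ p = 1 := by
  revert p
  decide

theorem gsign_zero : gsign 0 = 1 := by simp [gsign]

theorem gsign_one : gsign 1 = -1 := by simp [gsign]

theorem gsign_add (a b : ZMod 2) : gsign (a + b) = gsign a * gsign b := by
  have h : (1 : ZMod 2) + 1 = 0 := by decide
  rcases a.two_cases with rfl | rfl <;> rcases b.two_cases with rfl | rfl <;>
    simp [gsign, h]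

theorem gsign_mul_self (a : ZMod 2) : gsign a * gsign a = 1 := by
  rcases a.two_cases with rfl | rfl <;> simp [gsign]

namespace FieldChart

variable {M : FieldChart}

variable (M) in
/-- The grade involution, acting as `(-1)^e` on the functions of Grassmann parity `e`. -/
def tau : M.Alg →ₐ[ℝ] M.Alg :=
  Algebra.TensorProduct.map (AlgHom.id ℝ M.Body)
    (CliffordAlgebra.involute (Q := (0 : QuadraticForm ℝ (M.OddJet →₀ ℝ))))

theorem tau_tmul (a : M.Body) (b : M.Grass) :
    M.tau (a ⊗ₜ b) = a ⊗ₜ CliffordAlgebra.involute b := rfl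

theorem hasParity_iff {f : M.Alg} {e : ZMod 2} : HasParity f e ↔ M.tau f = gsign e • f := Iff.rfl

@[elab_as_elim]
theorem alg_induction {p : M.Alg → Prop} (tmul : ∀ (a : M.Body) (b : M.Grass), p (a ⊗ₜ b))
    (add : ∀ f g, p f → p g → p (f + g)) (f : M.Alg) : p f :=
  TensorProduct.induction_on f (by simpa using tmul 0 0) tmul add

theorem tau_tau (f : M.Alg) : M.tau (M.tau f) = f := by
  induction f using alg_induction with
  | tmul a b => simp [tau_tmul]
  | add f g hf hg => simp [hf, hg]

theorem involute_involute_grass (b : M.Grass) :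
    CliffordAlgebra.involute (CliffordAlgebra.involute b) = b :=
  CliffordAlgebra.involute_involute b

/-- `f + tau f` is twice the even part of `f`, and even elements are central. With the companion
identity for the odd part this encodes graded commutativity without homogeneity hypotheses. -/
theorem mul_add_tau (f g : M.Alg) : g * (f + M.tau f) = (f + M.tau f) * g := by
  induction f using alg_induction with
  | tmul a b =>
    induction g using alg_induction with
    | tmul c d =>
      rw [tau_tmul, ← TensorProduct.tmul_add, Algebra.TensorProduct.tmul_mul_tmul,
        Algebra.TensorProduct.tmul_mul_tmul, _root_.mul_comm c,
        ExteriorAlgebra.mul_comm_of_involute_eq]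
      rw [map_add, involute_involute_grass, add_comm]
    | add f g hf hg => rw [add_mul, hf, hg, mul_add]
  | add f f' hf hf' =>
    rw [map_add, add_add_add_comm, mul_add, add_mul, hf, hf']

theorem mul_sub_tau (f g : M.Alg) :
    g * (f + (-1 : ℝ) • M.tau f) = (f + (-1 : ℝ) • M.tau f) * M.tau g := by
  induction f using alg_induction with
  | tmul a b =>
    induction g using alg_induction with
    | tmul c d =>
      rw [tau_tmul, tau_tmul, ← TensorProduct.tmul_smul, ← TensorProduct.tmul_add,
        Algebra.TensorProduct.tmul_mul_tmul, Algebra.TensorProduct.tmul_mul_tmul,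
        _root_.mul_comm c, ExteriorAlgebra.mul_comm_of_involute_eq_neg]
      rw [map_add, map_smul, involute_involute_grass, neg_one_smul, neg_one_smul, neg_add_rev, neg_neg]
    | add f g hf hg => rw [add_mul, map_add, hf, hg, mul_add]
  | add f f' hf hf' =>
    rw [map_add, smul_add, add_add_add_comm, mul_add, add_mul, hf, hf']

theorem jet_of_even {v : M.Gen} (h : v.parity = 0) (Λ : MultiIdx M.n) :
    jet v Λ = JetFun.coord M.jetDom (.inr ⟨(v, Λ), h⟩) ⊗ₜ (1 : M.Grass) := dif_pos h

theorem jet_of_odd {v : M.Gen} (h : v.parity ≠ 0) (Λ : MultiIdx M.n) :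
    jet v Λ = (1 : M.Body) ⊗ₜ
      ExteriorAlgebra.ι ℝ (Finsupp.single (⟨(v, Λ), h⟩ : M.OddJet) 1) := dif_neg h

theorem lderiv_of_even {v : M.Gen} (h : v.parity = 0) (Λ : MultiIdx M.n) (a : M.Body)
    (b : M.Grass) : lderiv v Λ (a ⊗ₜ b) = JetFun.pd M.jetDom (.inr ⟨(v, Λ), h⟩) a ⊗ₜ b := by
  rw [lderiv, dif_pos h]
  rfl

theorem lderiv_of_odd {v : M.Gen} (h : v.parity ≠ 0) (Λ : MultiIdx M.n) (a : M.Body)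
    (b : M.Grass) : lderiv v Λ (a ⊗ₜ b)
      = a ⊗ₜ CliffordAlgebra.contractLeft (Finsupp.lapply (⟨(v, Λ), h⟩ : M.OddJet)) b := by
  rw [lderiv, dif_neg h]
  rfl

theorem xderiv_tmul (l : Fin M.n) (a : M.Body) (b : M.Grass) :
    xderiv l (a ⊗ₜ b) = JetFun.pd M.jetDom (.inl l) a ⊗ₜ b := rfl

theorem parity_ne_zero_iff {v : M.Gen} : v.parity ≠ 0 ↔ v.parity = 1 := by
  rcases v.parity.two_cases with h | h <;> simp [h]

theorem hasParity_jet (v : M.Gen) (Λ : MultiIdx M.n) : HasParity (jet v Λ) v.parity := by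
  rw [hasParity_iff]
  by_cases h : v.parity = 0
  · rw [jet_of_even h, tau_tmul, map_one, h, gsign_zero, one_smul]
  · rw [jet_of_odd h, tau_tmul, parity_ne_zero_iff.1 h, gsign_one]
    erw [CliffordAlgebra.involute_ι]
    rw [← TensorProduct.tmul_smul, neg_one_smul]

theorem tau_lderiv (v : M.Gen) (Λ : MultiIdx M.n) (f : M.Alg) :
    M.tau (lderiv v Λ f) = gsign v.parity • lderiv v Λ (M.tau f) := by
  induction f using alg_induction with
  | tmul a b =>
    by_cases h : v.parity = 0
    · rw [lderiv_of_even h, tau_tmul, tau_tmul, lderiv_of_even h, h, gsign_zero, one_smul]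
    · rw [lderiv_of_odd h, tau_tmul, tau_tmul, lderiv_of_odd h, parity_ne_zero_iff.1 h, gsign_one,
        CliffordAlgebra.involute_contractLeft, ← TensorProduct.tmul_smul, neg_one_smul]
  | add f g hf hg => simp only [map_add, hf, hg, smul_add]

theorem tau_xderiv (l : Fin M.n) (f : M.Alg) : M.tau (xderiv l f) = xderiv l (M.tau f) := by
  induction f using alg_induction with
  | tmul a b => rfl
  | add f g hf hg => simp only [map_add, hf, hg]

theorem lderiv_mul (v : M.Gen) (Λ : MultiIdx M.n) (f g : M.Alg) :
    lderiv v Λ (f * g) = lderiv v Λ f * g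
      + (if v.parity = 0 then f else M.tau f) * lderiv v Λ g := by
  induction f using alg_induction with
  | tmul a b =>
    induction g using alg_induction with
    | tmul c d =>
      by_cases h : v.parity = 0
      · rw [if_pos h, Algebra.TensorProduct.tmul_mul_tmul, lderiv_of_even h,
          lderiv_of_even h, lderiv_of_even h, JetFun.pd_mul, TensorProduct.add_tmul,
          Algebra.TensorProduct.tmul_mul_tmul, Algebra.TensorProduct.tmul_mul_tmul]
      · rw [if_neg h, Algebra.TensorProduct.tmul_mul_tmul,
          lderiv_of_odd h, lderiv_of_odd h, lderiv_of_odd h, CliffordAlgebra.contractLeft_mul,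
          TensorProduct.tmul_add, tau_tmul, Algebra.TensorProduct.tmul_mul_tmul,
          Algebra.TensorProduct.tmul_mul_tmul]
    | add g g' hg hg' => simp only [mul_add, map_add, hg, hg']; abel
  | add f f' hf hf' => split_ifs at * <;> simp only [add_mul, map_add, hf, hf'] <;> abel

theorem xderiv_mul (l : Fin M.n) (f g : M.Alg) :
    xderiv l (f * g) = xderiv l f * g + f * xderiv l g := by
  induction f using alg_induction with
  | tmul a b =>
    induction g using alg_induction with
    | tmul c d =>
      rw [Algebra.TensorProduct.tmul_mul_tmul, xderiv_tmul, JetFun.pd_mul, TensorProduct.add_tmul,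
        xderiv_tmul, xderiv_tmul, Algebra.TensorProduct.tmul_mul_tmul,
        Algebra.TensorProduct.tmul_mul_tmul]
    | add g g' hg hg' => simp only [mul_add, map_add, hg, hg']; abel
  | add f f' hf hf' => simp only [add_mul, map_add, hf, hf']; abel

/-- Derivatives of different kinds act on different tensor factors; two even ones commute as partial
derivatives, and two odd ones anticommute as contractions. -/
theorem lderiv_comm (v w : M.Gen) (Λ S : MultiIdx M.n) (f : M.Alg) :
    lderiv v Λ (lderiv w S f) = gsign (v.parity * w.parity) • lderiv w S (lderiv v Λ f) := by
  induction f using alg_induction with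
  | tmul a b =>
    by_cases h : v.parity = 0 <;> by_cases h' : w.parity = 0
    · rw [lderiv_of_even h, lderiv_of_even h', lderiv_of_even h', lderiv_of_even h, h,
        JetFun.pd_comm, zero_mul, gsign_zero, one_smul]
    · rw [lderiv_of_even h, lderiv_of_odd h', lderiv_of_odd h', lderiv_of_even h, h,
        zero_mul, gsign_zero, one_smul]
    · rw [lderiv_of_odd h, lderiv_of_even h', lderiv_of_even h', lderiv_of_odd h, h',
        mul_zero, gsign_zero, one_smul]
    · rw [lderiv_of_odd h, lderiv_of_odd h', lderiv_of_odd h', lderiv_of_odd h,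
        CliffordAlgebra.contractLeft_comm, parity_ne_zero_iff.1 h, parity_ne_zero_iff.1 h',
        mul_one, gsign_one, ← TensorProduct.tmul_smul, neg_one_smul]
  | add f g hf hg => simp only [map_add, hf, hg, smul_add]

theorem xderiv_comm (l m : Fin M.n) (f : M.Alg) : xderiv l (xderiv m f) = xderiv m (xderiv l f) := by
  induction f using alg_induction with
  | tmul a b => rw [xderiv_tmul, xderiv_tmul, xderiv_tmul, xderiv_tmul, JetFun.pd_comm]
  | add f g hf hg => simp only [map_add, hf, hg]

theorem lderiv_xderiv (v : M.Gen) (Λ : MultiIdx M.n) (l : Fin M.n) (f : M.Alg) :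
    lderiv v Λ (xderiv l f) = xderiv l (lderiv v Λ f) := by
  induction f using alg_induction with
  | tmul a b =>
    by_cases h : v.parity = 0
    · rw [xderiv_tmul, lderiv_of_even h, lderiv_of_even h, xderiv_tmul, JetFun.pd_comm]
    · rw [xderiv_tmul, lderiv_of_odd h, lderiv_of_odd h, xderiv_tmul]
  | add f g hf hg => simp only [map_add, hf, hg]

theorem rderiv_eq (v : M.Gen) (Λ : MultiIdx M.n) (f : M.Alg) :
    rderiv v Λ f
      = if v.parity = 0 then lderiv v Λ f else M.tau (lderiv v Λ f) := by
  by_cases h : v.parity = 0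
  · rw [rderiv, lderiv, dif_pos h, dif_pos h, if_pos h]
  · rw [if_neg h]
    induction f using alg_induction with
    | tmul a b =>
      rw [lderiv_of_odd h, tau_tmul, rderiv, dif_neg h, ← CliffordAlgebra.contractRight_eq_involute]
      rfl
    | add f g hf hg => simp only [map_add, hf, hg]

open Classical in
theorem lderiv_jet (v w : M.Gen) (Λ S : MultiIdx M.n) :
    lderiv v Λ (jet w S) = if w = v ∧ S = Λ then 1 else 0 := by
  by_cases h : v.parity = 0 <;> by_cases h' : w.parity = 0
  · rw [jet_of_even h', lderiv_of_even h, JetFun.pd_coord]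
    by_cases hc : w = v ∧ S = Λ
    · obtain ⟨rfl, rfl⟩ := hc
      simp [Algebra.TensorProduct.one_def]
    · rw [if_neg hc, if_neg, TensorProduct.zero_tmul]
      simpa using hc
  · rw [jet_of_odd h', lderiv_of_even h, if_neg (by rintro ⟨rfl, -⟩; exact h' h)]
    have : JetFun.pd M.jetDom (.inr ⟨(v, Λ), h⟩) (1 : M.Body) = 0 :=
      JetFun.pd_eq_zero_of_forall_update _ _ fun _ _ _ => rfl
    rw [this, TensorProduct.zero_tmul]
  · rw [jet_of_even h', lderiv_of_odd h, CliffordAlgebra.contractLeft_one, TensorProduct.tmul_zero,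
      if_neg (by rintro ⟨rfl, -⟩; exact h h')]
  · rw [jet_of_odd h', lderiv_of_odd h]
    erw [CliffordAlgebra.contractLeft_ι]
    rw [Finsupp.lapply_apply, Finsupp.single_apply]
    by_cases hc : w = v ∧ S = Λ
    · obtain ⟨rfl, rfl⟩ := hc
      simp [Algebra.TensorProduct.one_def]
    · rw [if_neg hc, if_neg, map_zero, TensorProduct.tmul_zero]
      simpa using hc

theorem xderiv_jet (l : Fin M.n) (w : M.Gen) (S : MultiIdx M.n) : xderiv l (jet w S) = 0 := by
  by_cases h : w.parity = 0
  · rw [jet_of_even h, xderiv_tmul, JetFun.pd_coord, if_neg (by simp), TensorProduct.zero_tmul]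
  · have : JetFun.pd M.jetDom (.inl l) (1 : M.Body) = 0 :=
      JetFun.pd_eq_zero_of_forall_update _ _ fun _ _ _ => rfl
    rw [jet_of_odd h, xderiv_tmul, this, TensorProduct.zero_tmul]

theorem finite_lderiv_ne_zero (f : M.Alg) : {j : M.Jet | lderiv j.1 j.2 f ≠ 0}.Finite := by
  induction f using alg_induction with
  | tmul a b =>
    have h1 := ((JetFun.finite_pd_ne_zero a).preimage
      (Sum.inr_injective (α := Fin M.n)).injOn).image Subtype.val
    have h2 := (ExteriorAlgebra.finite_contractLeft_lapply_ne_zero b).image Subtype.val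
    refine (h1.union h2).subset ?_
    rintro ⟨v, Λ⟩ hj
    by_cases h : v.parity = 0
    · refine Or.inl ⟨⟨(v, Λ), h⟩, fun hz => hj ?_, rfl⟩
      rw [lderiv_of_even h, hz, TensorProduct.zero_tmul]
    · refine Or.inr ⟨⟨(v, Λ), h⟩, fun hz => hj ?_, rfl⟩
      rw [lderiv_of_odd h, hz, TensorProduct.tmul_zero]
  | add f g hf hg =>
    refine (hf.union hg).subset fun j hj => ?_
    by_contra h
    simp only [Set.mem_union, Set.mem_ofPred_eq, not_or, not_not] at h
    exact hj (by rw [map_add, h.1, h.2, add_zero])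

/-- The derivative kills the generators of the subalgebra, and by the Leibniz rule the elements it
kills are closed under products. This makes the coefficients and the Lagrangian independent of
ghosts and antifields. -/
theorem lderiv_eq_zero_of_mem_fieldAlg {v : M.Gen} (hv : ∀ A, v ≠ .field 0 A) (Λ : MultiIdx M.n)
    {f : M.Alg} (hf : f ∈ M.fieldAlg) : lderiv v Λ f = 0 := by
  have h1 : ∀ {w : M.Gen}, lderiv w Λ (1 : M.Alg) = 0 := by
    intro w
    rw [Algebra.TensorProduct.one_def]
    by_cases h : w.parity = 0
    · have : JetFun.pd M.jetDom (.inr ⟨(w, Λ), h⟩) (1 : M.Body) = 0 :=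
        JetFun.pd_eq_zero_of_forall_update _ _ fun _ _ _ => rfl
      rw [lderiv_of_even h, this, TensorProduct.zero_tmul]
    · rw [lderiv_of_odd h, CliffordAlgebra.contractLeft_one, TensorProduct.tmul_zero]
  induction hf using Algebra.adjoin_induction with
  | mem f hf =>
    rcases hf with ⟨g, hg, rfl⟩ | ⟨A, S, hA, rfl⟩
    · by_cases h : v.parity = 0
      · rw [lderiv_of_even h, JetFun.pd_eq_zero_of_forall_update, TensorProduct.zero_tmul]
        refine fun z w hzw => hg z w fun c hc => hzw c ?_
        rintro rfl
        rcases hc with ⟨l, hl⟩ | ⟨A, S, h', hA⟩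
        · simp at hl
        · simp only [Sum.inr.injEq, Subtype.mk.injEq, Prod.mk.injEq] at hA
          exact hv A hA.1
      · rw [lderiv_of_odd h, CliffordAlgebra.contractLeft_one, TensorProduct.tmul_zero]
    · rw [lderiv_jet, if_neg fun h => hv A h.1.symm]
  | algebraMap r => rw [Algebra.algebraMap_eq_smul_one, map_smul, h1, smul_zero]
  | add f g _ _ hf hg => rw [map_add, hf, hg, add_zero]
  | mul f g _ _ hf hg => rw [lderiv_mul, hf, hg, zero_mul, mul_zero, add_zero]

end FieldChart

/-! ### Abstract jet calculus: parity, total derivatives, Leibniz rule. -/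

/-- The differential calculus on a graded commutative algebra `P` of functions of the
coordinates `x^l` and of the jets of a family `G` of even and odd variables. -/
structure JetCalculus (G : Type) (n : ℕ) (P : Type) [Ring P] [Algebra ℝ P] where
  par : G → ZMod 2
  tau : P →ₐ[ℝ] P
  tau_tau : ∀ f, tau (tau f) = f
  mul_add_tau : ∀ f g, g * (f + tau f) = (f + tau f) * g
  mul_sub_tau : ∀ f g, g * (f + (-1 : ℝ) • tau f) = (f + (-1 : ℝ) • tau f) * tau g
  jet : G → MultiIdx n → P
  xderiv : Fin n → P →ₗ[ℝ] P
  lderiv : G → MultiIdx n → P →ₗ[ℝ] P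
  tau_jet : ∀ v Λ, tau (jet v Λ) = gsign (par v) • jet v Λ
  tau_xderiv : ∀ l f, tau (xderiv l f) = xderiv l (tau f)
  tau_lderiv : ∀ v Λ f, tau (lderiv v Λ f) = gsign (par v) • lderiv v Λ (tau f)
  xderiv_mul : ∀ l f g, xderiv l (f * g) = xderiv l f * g + f * xderiv l g
  lderiv_mul : ∀ v Λ f g, lderiv v Λ (f * g)
    = lderiv v Λ f * g + (if par v = 0 then f else tau f) * lderiv v Λ g
  xderiv_comm : ∀ l m f, xderiv l (xderiv m f) = xderiv m (xderiv l f)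
  lderiv_xderiv : ∀ v Λ l f, lderiv v Λ (xderiv l f) = xderiv l (lderiv v Λ f)
  lderiv_comm : ∀ v w Λ S f,
    lderiv v Λ (lderiv w S f) = gsign (par v * par w) • lderiv w S (lderiv v Λ f)
  xderiv_jet : ∀ l v Λ, xderiv l (jet v Λ) = 0
  lderiv_jet_self : ∀ v Λ, lderiv v Λ (jet v Λ) = 1
  lderiv_jet_of_ne : ∀ v w Λ S, (w, S) ≠ (v, Λ) → lderiv v Λ (jet w S) = 0
  finite_lderiv_ne_zero : ∀ f, {j : G × MultiIdx n | lderiv j.1 j.2 f ≠ 0}.Finite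

/-- The shift by `l` is injective and its image misses only the indices with zero `l`-component. It
is used to telescope the sums coming from [∂_v^Λ, d_l]. -/
theorem finsum_eq_finsum_add_single {n : ℕ} {A : Type*} [AddCommMonoid A] (l : Fin n)
    (g : MultiIdx n → A) (hg : ∀ Λ : MultiIdx n, Λ l = 0 → g Λ = 0) :
    ∑ᶠ Λ, g Λ = ∑ᶠ S : MultiIdx n, g (S + Finsupp.single l 1) := by
  have hi : Function.Injective fun S : MultiIdx n => S + Finsupp.single l 1 :=
    add_left_injective _
  rw [← finsum_mem_range (f := g) hi]
  refine finsum_congr fun Λ => ?_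
  by_cases h : Λ ∈ Set.range fun S : MultiIdx n => S + Finsupp.single l 1
  · simp only [h, finsum_true]
  · simp only [h, finsum_false]
    refine hg Λ (by_contra fun h' => h ?_)
    obtain ⟨S, rfl⟩ := MultiIdx.exists_eq_add_single h'
    exact ⟨S, rfl⟩

theorem LinearMap.map_finsum_of_finite {R A B ι : Type*} [Semiring R] [AddCommMonoid A]
    [AddCommMonoid B] [Module R A] [Module R B] (L : A →ₗ[R] B) {f : ι → A}
    (hf : (Function.support f).Finite) : L (∑ᶠ i, f i) = ∑ᶠ i, L (f i) :=
  AddMonoidHom.map_finsum L.toAddMonoidHom hf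

namespace JetCalculus

variable {G : Type} {n : ℕ} {P : Type} [Ring P] [Algebra ℝ P] (J : JetCalculus G n P)

/-- The power of the grade involution with exponent a Grassmann parity. -/
def tauPow (p : ZMod 2) : P →ₐ[ℝ] P := if p = 0 then AlgHom.id ℝ P else J.tau

theorem tauPow_zero : J.tauPow 0 = AlgHom.id ℝ P := if_pos rfl

theorem tauPow_one : J.tauPow 1 = J.tau := if_neg one_ne_zero

theorem tauPow_apply (p : ZMod 2) (f : P) : J.tauPow p f = if p = 0 then f else J.tau f := by
  unfold tauPow
  split_ifs <;> rfl

theorem tauPow_tauPow (p : ZMod 2) (f : P) : J.tauPow p (J.tauPow p f) = f := by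
  rcases p.two_cases with rfl | rfl
  · simp [tauPow_zero]
  · simp [tauPow_one, J.tau_tau]

theorem lderiv_mul' (v : G) (Λ : MultiIdx n) (f g : P) : J.lderiv v Λ (f * g)
    = J.lderiv v Λ f * g + J.tauPow (J.par v) f * J.lderiv v Λ g := by
  rw [J.lderiv_mul, tauPow_apply]

/-- `f` is homogeneous of Grassmann parity `e`. -/
def HasParity (f : P) (e : ZMod 2) : Prop := J.tau f = gsign e • f

variable {J}

theorem HasParity.tauPow {f : P} {e : ZMod 2} (hf : J.HasParity f e) (p : ZMod 2) :
    J.tauPow p f = gsign (p * e) • f := by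
  rcases p.two_cases with rfl | rfl
  · simp [tauPow_zero, gsign_zero]
  · rw [tauPow_one, one_mul]
    exact hf

theorem HasParity.add {f g : P} {e : ZMod 2} (hf : J.HasParity f e) (hg : J.HasParity g e) :
    J.HasParity (f + g) e := by
  unfold HasParity at *
  rw [map_add, hf, hg, smul_add]

theorem HasParity.smul {f : P} {e : ZMod 2} (c : ℝ) (hf : J.HasParity f e) :
    J.HasParity (c • f) e := by
  unfold HasParity at *
  rw [map_smul, hf, smul_comm]

theorem HasParity.finsum {ι : Type*} {f : ι → P} {e : ZMod 2} (hf : ∀ i, J.HasParity (f i) e) :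
    J.HasParity (∑ᶠ i, f i) e :=
  finsum_induction (J.HasParity · e) (by simp [HasParity]) (fun _ _ => HasParity.add) hf

/-- Graded commutativity. -/
theorem HasParity.mul_eq {f : P} {e : ZMod 2} (hf : J.HasParity f e) (g : P) :
    f * g = J.tauPow e g * f := by
  unfold HasParity at hf
  rcases e.two_cases with rfl | rfl
  · have := J.mul_add_tau f g
    rw [hf, gsign_zero, one_smul, ← two_smul ℝ f, mul_smul_comm, smul_mul_assoc] at this
    exact (smul_right_injective _ (two_ne_zero (α := ℝ)) this).symm
  · have := J.mul_sub_tau f (J.tau g)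
    rw [hf, gsign_one, smul_smul, neg_one_mul, neg_neg, one_smul, J.tau_tau, ← two_smul ℝ f,
      mul_smul_comm, smul_mul_assoc] at this
    rw [tauPow_one]
    exact (smul_right_injective _ (two_ne_zero (α := ℝ)) this).symm

theorem HasParity.mul_comm {f g : P} {e e' : ZMod 2} (hf : J.HasParity f e)
    (hg : J.HasParity g e') : f * g = gsign (e * e') • (g * f) := by
  rw [hf.mul_eq, hg.tauPow, smul_mul_assoc]

variable (J)

theorem hasParity_jet (v : G) (Λ : MultiIdx n) : J.HasParity (J.jet v Λ) (J.par v) := J.tau_jet v Λ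

theorem HasParity.lderiv {J : JetCalculus G n P} {f : P} {e : ZMod 2} (hf : J.HasParity f e)
    (v : G) (Λ : MultiIdx n) : J.HasParity (J.lderiv v Λ f) (J.par v + e) := by
  unfold HasParity at *
  rw [J.tau_lderiv, hf, map_smul, smul_smul, gsign_add]

/-- `f` depends at most on the jets belonging to `T`. -/
def SuppIn (T : Finset (G × MultiIdx n)) (f : P) : Prop := ∀ j ∉ T, J.lderiv j.1 j.2 f = 0

/-- A common finite set of jets for several functions lets all their total derivatives be written as
sums over the same `Finset`. -/
theorem exists_suppIn (L : List P) : ∃ T, ∀ f ∈ L, J.SuppIn T f := by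
  classical
  induction L with
  | nil => exact ⟨∅, by simp⟩
  | cons f L ih =>
    obtain ⟨T, hT⟩ := ih
    refine ⟨(J.finite_lderiv_ne_zero f).toFinset ∪ T, fun g hg j hj => ?_⟩
    rw [Finset.mem_union, not_or] at hj
    rcases List.mem_cons.1 hg with rfl | hg
    · simpa using hj.1
    · exact hT g hg j hj.2

variable {J} in
theorem SuppIn.lderiv {T : Finset (G × MultiIdx n)} {f : P} (hf : J.SuppIn T f) (v : G)
    (Λ : MultiIdx n) : J.SuppIn T (J.lderiv v Λ f) := fun j hj => by
  rw [J.lderiv_comm, hf j hj, map_zero, smul_zero]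

variable {J} in
theorem SuppIn.xderiv {T : Finset (G × MultiIdx n)} {f : P} (hf : J.SuppIn T f) (l : Fin n) :
    J.SuppIn T (J.xderiv l f) := fun j hj => by
  rw [J.lderiv_xderiv, hf j hj, map_zero]

/-- The total derivative. -/
def dtot (l : Fin n) (f : P) : P :=
  J.xderiv l f
    + ∑ᶠ j : G × MultiIdx n, J.jet j.1 (j.2 + Finsupp.single l 1) * J.lderiv j.1 j.2 f

variable {J} in
theorem SuppIn.dtot_eq {T : Finset (G × MultiIdx n)} {f : P} (hf : J.SuppIn T f) (l : Fin n) :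
    J.dtot l f = J.xderiv l f
      + ∑ j ∈ T, J.jet j.1 (j.2 + Finsupp.single l 1) * J.lderiv j.1 j.2 f := by
  rw [dtot, finsum_eq_sum_of_support_subset (s := T)]
  intro j hj
  by_contra h
  exact hj (by dsimp only; rw [hf j h, mul_zero])

theorem dtot_add (l : Fin n) (f g : P) : J.dtot l (f + g) = J.dtot l f + J.dtot l g := by
  obtain ⟨T, hT⟩ := J.exists_suppIn [f, g, f + g]
  rw [(hT f (by simp)).dtot_eq, (hT g (by simp)).dtot_eq, (hT (f + g) (by simp)).dtot_eq]
  simp only [map_add, mul_add, Finset.sum_add_distrib]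
  abel

theorem dtot_smul (l : Fin n) (c : ℝ) (f : P) : J.dtot l (c • f) = c • J.dtot l f := by
  obtain ⟨T, hT⟩ := J.exists_suppIn [f, c • f]
  rw [(hT f (by simp)).dtot_eq, (hT (c • f) (by simp)).dtot_eq]
  simp only [map_smul, mul_smul_comm, smul_add, Finset.smul_sum]

/-- The total derivative as a linear map. -/
def dtotLin (l : Fin n) : P →ₗ[ℝ] P where
  toFun := J.dtot l
  map_add' := J.dtot_add l
  map_smul' := J.dtot_smul l

theorem dtotLin_apply (l : Fin n) (f : P) : J.dtotLin l f = J.dtot l f := rfl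

theorem dtot_mul (l : Fin n) (f g : P) : J.dtot l (f * g) = J.dtot l f * g + f * J.dtot l g := by
  obtain ⟨T, hT⟩ := J.exists_suppIn [f, g, f * g]
  rw [(hT f (by simp)).dtot_eq, (hT g (by simp)).dtot_eq, (hT (f * g) (by simp)).dtot_eq,
    J.xderiv_mul, add_mul, mul_add, Finset.sum_mul, Finset.mul_sum]
  have : ∀ j ∈ T, J.jet j.1 (j.2 + Finsupp.single l 1) * J.lderiv j.1 j.2 (f * g)
      = J.jet j.1 (j.2 + Finsupp.single l 1) * J.lderiv j.1 j.2 f * g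
        + f * (J.jet j.1 (j.2 + Finsupp.single l 1) * J.lderiv j.1 j.2 g) := by
    intro j _
    -- The twist of `f` from the graded Leibniz rule is undone by moving the jet, of the same parity
    -- as the derivative, past `f`; thus total derivatives are even.
    rw [lderiv_mul', mul_add, ← mul_assoc, ← mul_assoc, (J.hasParity_jet _ _).mul_eq
      (J.tauPow _ f), tauPow_tauPow, mul_assoc f]
  rw [Finset.sum_congr rfl this, Finset.sum_add_distrib]
  abel

theorem dtot_jet (l : Fin n) (v : G) (Λ : MultiIdx n) :
    J.dtot l (J.jet v Λ) = J.jet v (Λ + Finsupp.single l 1) := by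
  rw [dtot, J.xderiv_jet, zero_add, finsum_eq_single _ (v, Λ), J.lderiv_jet_self, mul_one]
  intro j hj
  rw [J.lderiv_jet_of_ne _ _ _ _ hj.symm, mul_zero]

theorem tau_dtot (l : Fin n) (f : P) : J.tau (J.dtot l f) = J.dtot l (J.tau f) := by
  obtain ⟨T, hT⟩ := J.exists_suppIn [f, J.tau f]
  rw [(hT f (by simp)).dtot_eq, (hT (J.tau f) (by simp)).dtot_eq, map_add, J.tau_xderiv, map_sum]
  congr 1
  refine Finset.sum_congr rfl fun j _ => ?_
  rw [map_mul, J.tau_jet, J.tau_lderiv, smul_mul_smul_comm, gsign_mul_self, one_smul]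

variable {J} in
theorem HasParity.dtot {f : P} {e : ZMod 2} (hf : J.HasParity f e) (l : Fin n) :
    J.HasParity (J.dtot l f) e := by
  unfold HasParity at *
  rw [tau_dtot, hf, dtot_smul]

/-- The commutator [∂_v^Λ, d_l] comes solely from differentiating the explicit coefficient v_Λ in
d_l, which multiplies ∂_v^{Λ-l} and is present only if `l` occurs in Λ. -/
theorem lderiv_dtot (v : G) (Λ : MultiIdx n) (l : Fin n) (f : P) :
    J.lderiv v Λ (J.dtot l f) = J.dtot l (J.lderiv v Λ f)
      + if Λ l = 0 then 0 else J.lderiv v (Λ - Finsupp.single l 1) f := by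
  classical
  obtain ⟨T, hT⟩ := J.exists_suppIn [f]
  replace hT := hT f (by simp)
  rw [hT.dtot_eq, (hT.lderiv v Λ).dtot_eq, map_add, J.lderiv_xderiv, map_sum, add_assoc]
  congr 1
  have h1 : ∀ j ∈ T, J.lderiv v Λ (J.jet j.1 (j.2 + Finsupp.single l 1) * J.lderiv j.1 j.2 f)
      = J.jet j.1 (j.2 + Finsupp.single l 1) * J.lderiv j.1 j.2 (J.lderiv v Λ f)
        + if (v, Λ) = (j.1, j.2 + Finsupp.single l 1) then J.lderiv j.1 j.2 f else 0 := by
    intro j _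
    rw [lderiv_mul', (J.hasParity_jet _ _).tauPow, J.lderiv_comm, smul_mul_smul_comm,
      gsign_mul_self, one_smul, add_comm]
    congr 1
    split_ifs with h
    · rw [Prod.mk.injEq] at h
      obtain ⟨rfl, rfl⟩ := h
      rw [J.lderiv_jet_self, one_mul]
    · rw [J.lderiv_jet_of_ne _ _ _ _ (Ne.symm h), zero_mul]
  rw [Finset.sum_congr rfl h1, Finset.sum_add_distrib]
  congr 1
  split_ifs with hl
  · refine Finset.sum_eq_zero fun j _ => if_neg fun h => ?_
    rw [(Prod.mk.inj h).2] at hl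
    simp at hl
  · obtain ⟨S, rfl⟩ := MultiIdx.exists_eq_add_single hl
    rw [add_tsub_cancel_right]
    rw [Finset.sum_eq_single (v, S), if_pos rfl]
    · rintro ⟨w, S'⟩ _ hj
      refine if_neg fun h => hj ?_
      simp only [Prod.mk.injEq, add_left_inj] at h ⊢
      exact ⟨h.1.symm, h.2.symm⟩
    · intro h
      rw [hT _ h, ite_self]

theorem dtot_comm (l m : Fin n) (f : P) : J.dtot l (J.dtot m f) = J.dtot m (J.dtot l f) := by
  obtain ⟨T, hT⟩ := J.exists_suppIn [f]
  replace hT := hT f (by simp)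
  -- Full expansion over one finite set of jets. Every group of terms is visibly symmetric in `l`
  -- and `m`, except the last.
  have key : ∀ l m : Fin n, J.dtot l (J.dtot m f) = J.xderiv l (J.xderiv m f)
      + ∑ j ∈ T, (J.jet j.1 (j.2 + Finsupp.single l 1) * J.xderiv m (J.lderiv j.1 j.2 f)
        + J.jet j.1 (j.2 + Finsupp.single m 1) * J.xderiv l (J.lderiv j.1 j.2 f))
      + ∑ j ∈ T, J.jet j.1 (j.2 + Finsupp.single m 1 + Finsupp.single l 1) * J.lderiv j.1 j.2 f
      + ∑ j ∈ T, ∑ i ∈ T, J.jet j.1 (j.2 + Finsupp.single m 1)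
        * (J.jet i.1 (i.2 + Finsupp.single l 1) * J.lderiv i.1 i.2 (J.lderiv j.1 j.2 f)) := by
    intro l m
    rw [hT.dtot_eq m, dtot_add, (hT.xderiv m).dtot_eq, ← dtotLin_apply, map_sum]
    simp only [dtotLin_apply, dtot_mul, dtot_jet, J.lderiv_xderiv, (hT.lderiv _ _).dtot_eq,
      mul_add, Finset.mul_sum, Finset.sum_add_distrib]
    abel
  rw [key l m, key m l, J.xderiv_comm]
  congr 1
  · congr 1
    · congr 1
      exact Finset.sum_congr rfl fun j _ => add_comm _ _
    · exact Finset.sum_congr rfl fun j _ => by rw [add_right_comm]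
  · rw [Finset.sum_comm]
    refine Finset.sum_congr rfl fun i _ => Finset.sum_congr rfl fun j _ => ?_
    -- Exchanging the two jets and exchanging the two derivatives produce the same sign, so the
    -- signs cancel.
    rw [← mul_assoc, (J.hasParity_jet _ _).mul_comm (J.hasParity_jet _ _), J.lderiv_comm,
      smul_mul_smul_comm, mul_comm (J.par j.1), gsign_mul_self, one_smul, mul_assoc]

/-- The iterated total derivative. -/
def dmul (Λ : MultiIdx n) (f : P) : P :=
  (List.finRange n).foldr (fun l g => (J.dtot l)^[Λ l] g) f

theorem dmul_zero (f : P) : J.dmul 0 f = f := by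
  have : ∀ L : List (Fin n), L.foldr (fun l g => (J.dtot l)^[(0 : MultiIdx n) l] g) f = f := by
    intro L
    induction L with
    | nil => rfl
    | cons m L ih => simp
  exact this _

theorem dmul_dtot (Λ : MultiIdx n) (l : Fin n) (f : P) :
    J.dmul Λ (J.dtot l f) = J.dtot l (J.dmul Λ f) := by
  have : ∀ L : List (Fin n), L.foldr (fun l g => (J.dtot l)^[Λ l] g) (J.dtot l f)
      = J.dtot l (L.foldr (fun l g => (J.dtot l)^[Λ l] g) f) := by
    intro L
    induction L with
    | nil => rfl
    | cons m L ih =>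
      rw [List.foldr_cons, List.foldr_cons, ih]
      have hc : Function.Commute (J.dtot m) (J.dtot l) := J.dtot_comm m l
      exact (hc.iterate_left (Λ m)) _
  exact this _

theorem dmul_add_single (Λ : MultiIdx n) (l : Fin n) (f : P) :
    J.dmul (Λ + Finsupp.single l 1) f = J.dtot l (J.dmul Λ f) := by
  classical
  -- The extra d_l is inserted where `l` occurs in the fold and is then commuted outwards; absence
  -- of repetitions ensures it is inserted only once.
  have h : ∀ L : List (Fin n), L.Nodup →
      L.foldr (fun m g => (J.dtot m)^[(Λ + Finsupp.single l 1 : MultiIdx n) m] g) f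
        = if l ∈ L then J.dtot l (L.foldr (fun m g => (J.dtot m)^[Λ m] g) f)
          else L.foldr (fun m g => (J.dtot m)^[Λ m] g) f := by
    intro L hL
    induction L with
    | nil => rfl
    | cons m L ih =>
      obtain ⟨hm, hL⟩ := List.nodup_cons.1 hL
      rw [List.foldr_cons, List.foldr_cons, ih hL]
      by_cases hml : m = l
      · subst hml
        rw [if_neg hm, if_pos (by simp), Finsupp.add_apply, Finsupp.single_eq_same,
          Function.iterate_succ_apply']
      · have hc : Function.Commute (J.dtot m) (J.dtot l) := J.dtot_comm m l
        have h0 : (Λ + Finsupp.single l 1 : MultiIdx n) m = Λ m := by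
          simp [Ne.symm hml]
        rw [h0]
        by_cases hlL : l ∈ L
        · rw [if_pos hlL, if_pos (List.mem_cons_of_mem _ hlL)]
          exact (hc.iterate_left (Λ m)) _
        · rw [if_neg hlL, if_neg]
          simp [hlL, Ne.symm hml]
  have := h _ (List.nodup_finRange n)
  rwa [if_pos (List.mem_finRange l)] at this

theorem dmul_add (Λ : MultiIdx n) (f g : P) : J.dmul Λ (f + g) = J.dmul Λ f + J.dmul Λ g := by
  induction Λ using MultiIdx.induction_add_single with
  | zero => simp only [dmul_zero]
  | add U l ih => simp only [dmul_add_single, ih, dtot_add]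

theorem dmul_smul (Λ : MultiIdx n) (c : ℝ) (f : P) : J.dmul Λ (c • f) = c • J.dmul Λ f := by
  induction Λ using MultiIdx.induction_add_single with
  | zero => simp only [dmul_zero]
  | add U l ih => simp only [dmul_add_single, ih, dtot_smul]

/-- The iterated total derivative as a linear map. -/
def dmulLin (Λ : MultiIdx n) : P →ₗ[ℝ] P where
  toFun := J.dmul Λ
  map_add' := J.dmul_add Λ
  map_smul' := J.dmul_smul Λ

theorem dmul_map_zero (Λ : MultiIdx n) : J.dmul Λ 0 = 0 := map_zero (J.dmulLin Λ)

theorem dtot_map_zero (l : Fin n) : J.dtot l 0 = 0 := map_zero (J.dtotLin l)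

theorem dmul_finsum {ι : Type*} (Λ : MultiIdx n) {f : ι → P} (hf : (Function.support f).Finite) :
    J.dmul Λ (∑ᶠ i, f i) = ∑ᶠ i, J.dmul Λ (f i) :=
  (J.dmulLin Λ).map_finsum_of_finite hf

theorem dmul_dmul (Λ S : MultiIdx n) (f : P) : J.dmul Λ (J.dmul S f) = J.dmul (Λ + S) f := by
  induction Λ using MultiIdx.induction_add_single with
  | zero => rw [dmul_zero, zero_add]
  | add U l ih => rw [dmul_add_single, ih, add_right_comm, dmul_add_single]

theorem dmul_jet (S : MultiIdx n) (v : G) (Λ : MultiIdx n) :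
    J.dmul S (J.jet v Λ) = J.jet v (Λ + S) := by
  induction S using MultiIdx.induction_add_single with
  | zero => rw [dmul_zero, add_zero]
  | add U l ih => rw [dmul_add_single, ih, dtot_jet, add_assoc]

variable {J} in
theorem HasParity.dmul {f : P} {e : ZMod 2} (hf : J.HasParity f e) (Λ : MultiIdx n) :
    J.HasParity (J.dmul Λ f) e := by
  induction Λ using MultiIdx.induction_add_single with
  | zero => rwa [dmul_zero]
  | add U l ih =>
    rw [dmul_add_single]
    exact ih.dtot l

/-- The Leibniz rule for iterated total derivatives. -/
theorem dmul_mul (U : MultiIdx n) (f g : P) : J.dmul U (f * g)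
    = ∑ p ∈ Finset.HasAntidiagonal.antidiagonal U,
        p.1.binom p.2 • (J.dmul p.1 f * J.dmul p.2 g) := by
  classical
  induction U using MultiIdx.induction_add_single generalizing f g with
  | zero => simp [dmul_zero, MultiIdx.binom_zero_right]
  | add U l ih =>
    rw [MultiIdx.sum_antidiagonal_add_single U l fun a b => J.dmul a f * J.dmul b g,
      dmul_add_single, ← dmul_dtot, dtot_mul, dmul_add, ih, ih, ← Finset.sum_add_distrib]
    refine Finset.sum_congr rfl fun p _ => ?_
    rw [smul_add, dmul_add_single, dmul_add_single, dmul_dtot, dmul_dtot]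

theorem dmul_mul_swap (U : MultiIdx n) (f g : P) : J.dmul U (f * g)
    = ∑ p ∈ Finset.HasAntidiagonal.antidiagonal U,
        p.1.binom p.2 • (J.dmul p.2 f * J.dmul p.1 g) := by
  rw [dmul_mul]
  refine Finset.sum_nbij' Prod.swap Prod.swap ?_ ?_ (fun _ _ => rfl) (fun _ _ => rfl) ?_
  · exact fun p hp => by simpa [add_comm] using hp
  · exact fun p hp => by simpa [add_comm] using hp
  · exact fun p _ => by rw [Prod.fst_swap, Prod.snd_swap, MultiIdx.binom_comm]

end JetCalculus

/-! ### Formal adjoints, the involution η, and variational derivatives. -/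

namespace MultiIdx

variable {n : ℕ}

theorem finite_add_mem {s : Set (MultiIdx n)} (hs : s.Finite) :
    {p : MultiIdx n × MultiIdx n | p.1 + p.2 ∈ s}.Finite := by
  classical
  refine (hs.toFinset.biUnion fun U =>
    Finset.HasAntidiagonal.antidiagonal U).finite_toSet.subset fun p hp => ?_
  simp only [Finset.coe_biUnion, Set.mem_iUnion, Finset.mem_coe, Set.Finite.mem_toFinset,
    Finset.HasAntidiagonal.mem_antidiagonal]
  exact ⟨_, hp, rfl⟩

theorem neg_one_pow_mul_self (a : ℕ) : (-1 : ℝ) ^ a * (-1) ^ a = 1 := by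
  rw [← mul_pow]
  simp

end MultiIdx

theorem finite_support_slice {A B : Type*} {P : Type*} [Zero P] {F : A × B → P} (hF : (Function.support F).Finite)
    (a : A) : (Function.support fun b => F (a, b)).Finite :=
  hF.preimage (Prod.mk_right_injective a).injOn

namespace JetCalculus

variable {G : Type} {n : ℕ} {P : Type} [Ring P] [Algebra ℝ P] (J : JetCalculus G n P)

/-- The coefficients `η(f)` of the formal adjoint operator. -/
def eta (f : MultiIdx n → P) (Λ : MultiIdx n) : P :=
  ∑ᶠ S : MultiIdx n, ((-1 : ℝ) ^ (S + Λ).len * (S.binom Λ : ℝ)) • J.dmul S (f (S + Λ))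

theorem finite_support_eta_aux {f : MultiIdx n → P} (hf : (Function.support f).Finite) :
    (Function.support fun p : MultiIdx n × MultiIdx n =>
      ((-1 : ℝ) ^ (p.2 + p.1).len * (p.2.binom p.1 : ℝ)) • J.dmul p.2 (f (p.2 + p.1))).Finite := by
  refine (MultiIdx.finite_add_mem hf).subset fun p hp h => hp ?_
  dsimp only
  rw [add_comm p.2, h, dmul_map_zero, smul_zero]

theorem finite_support_eta {f : MultiIdx n → P} (hf : (Function.support f).Finite) :
    (Function.support (J.eta f)).Finite := by
  refine ((MultiIdx.finite_add_mem hf).image Prod.fst).subset fun S hS => ?_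
  by_contra h
  refine hS (finsum_eq_zero_of_forall_eq_zero fun T => ?_)
  have : f (T + S) = 0 := by_contra fun h' => h ⟨(S, T), by simpa [add_comm] using h', rfl⟩
  rw [this, dmul_map_zero, smul_zero]

/-- Integration by parts in terms of `η`, for a product `op` satisfying the Leibniz rule. -/
theorem finsum_dmul_op (op : P →ₗ[ℝ] P →ₗ[ℝ] P)
    (hop : ∀ U f g, J.dmul U (op f g) = ∑ p ∈ Finset.HasAntidiagonal.antidiagonal U,
      p.1.binom p.2 • op (J.dmul p.1 f) (J.dmul p.2 g))
    (u : P) {f : MultiIdx n → P} (hf : (Function.support f).Finite) :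
    ∑ᶠ X : MultiIdx n, (-1 : ℝ) ^ X.len • J.dmul X (op u (f X))
      = ∑ᶠ S, op (J.dmul S u) (J.eta f S) := by
  -- Indexed by (S, T), with d_S acting on `u` and d_T on the coefficient at T + S. Summing along S
  -- + T = X gives the Leibniz expansion, while summing over T gives η. No sign depends on the order
  -- of factors, which is why an arbitrary bilinear `op` is allowed.
  let F : MultiIdx n × MultiIdx n → P := fun p =>
    op (J.dmul p.1 u) (((-1 : ℝ) ^ (p.2 + p.1).len * (p.2.binom p.1 : ℝ)) •
      J.dmul p.2 (f (p.2 + p.1)))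
  have hF : (Function.support F).Finite :=
    (J.finite_support_eta_aux hf).subset fun p hp h => hp (by
      change op _ _ = 0
      dsimp only at h
      rw [h, map_zero])
  have h1 : ∀ X : MultiIdx n, (-1 : ℝ) ^ X.len • J.dmul X (op u (f X))
      = ∑ p ∈ Finset.HasAntidiagonal.antidiagonal X, F p := by
    intro X
    rw [hop, Finset.smul_sum]
    refine Finset.sum_congr rfl fun p hp => ?_
    rw [Finset.HasAntidiagonal.mem_antidiagonal] at hp
    simp only [F]
    rw [map_smul, add_comm p.2, hp, MultiIdx.binom_comm p.2, mul_smul, Nat.cast_smul_eq_nsmul]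
  rw [finsum_congr h1, MultiIdx.finsum_antidiagonal F hF]
  refine finsum_congr fun S => ?_
  exact ((op (J.dmul S u)).map_finsum_of_finite
    (finite_support_slice (J.finite_support_eta_aux hf) S)).symm

theorem finsum_dmul_mul_left (u : P) {f : MultiIdx n → P} (hf : (Function.support f).Finite) :
    ∑ᶠ X : MultiIdx n, (-1 : ℝ) ^ X.len • J.dmul X (u * f X)
      = ∑ᶠ S, J.dmul S u * J.eta f S :=
  J.finsum_dmul_op (LinearMap.mul ℝ P) J.dmul_mul u hf

theorem finsum_dmul_mul_right (w : P) {f : MultiIdx n → P} (hf : (Function.support f).Finite) :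
    ∑ᶠ X : MultiIdx n, (-1 : ℝ) ^ X.len • J.dmul X (f X * w)
      = ∑ᶠ S, J.eta f S * J.dmul S w :=
  J.finsum_dmul_op (LinearMap.mul ℝ P).flip (fun U f g => J.dmul_mul_swap U g f) w hf

/-- Taking the formal adjoint is an involution. -/
theorem eta_eta {f : MultiIdx n → P} (hf : (Function.support f).Finite) : J.eta (J.eta f) = f := by
  classical
  funext Λ
  -- The general term of η∘η after merging the two derivatives and rewriting the two binomials by
  -- `binom_mul_binom`. Apart from an alternating binomial factor it depends only on S + T, so
  -- grouping by that sum leaves only S = T = 0.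
  let F : MultiIdx n × MultiIdx n → P := fun p =>
    ((-1 : ℝ) ^ p.2.len * (p.1.binom p.2 * (p.1 + p.2).binom Λ : ℝ)) •
      J.dmul (p.1 + p.2) (f (p.1 + p.2 + Λ))
  have hs : {U : MultiIdx n | U + Λ ∈ Function.support f}.Finite :=
    hf.preimage (add_left_injective Λ).injOn
  have hF : (Function.support F).Finite := by
    refine (MultiIdx.finite_add_mem hs).subset fun p hp h => hp ?_
    simp only [F]
    rw [h, dmul_map_zero, smul_zero]
  have h1 : ∀ S : MultiIdx n,
      ((-1 : ℝ) ^ (S + Λ).len * (S.binom Λ : ℝ)) • J.dmul S (J.eta f (S + Λ))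
        = ∑ᶠ T, F (S, T) := by
    intro S
    rw [eta, J.dmul_finsum _ (finite_support_slice (J.finite_support_eta_aux hf) (S + Λ)),
      ← LinearMap.lsmul_apply (R := ℝ) (M := P), LinearMap.map_finsum_of_finite]
    · refine finsum_congr fun T => ?_
      rw [LinearMap.lsmul_apply, dmul_smul, smul_smul, dmul_dmul]
      simp only [F]
      have hb : (T.binom S * (T + S).binom Λ : ℝ) = (S + Λ).binom T * S.binom Λ := by
        exact_mod_cast MultiIdx.binom_mul_binom T S Λ
      rw [show T + (S + Λ) = S + T + Λ by abel, MultiIdx.binom_comm S T, add_comm S T, hb,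
        MultiIdx.binom_comm T]
      congr 1
      rw [show T + S + Λ = T + (S + Λ) by abel, MultiIdx.len_add T, pow_add]
      linear_combination ((-1 : ℝ) ^ T.len * (S.binom Λ : ℝ) * ((S + Λ).binom T : ℝ)) *
        MultiIdx.neg_one_pow_mul_self (S + Λ).len
    · refine (finite_support_slice (J.finite_support_eta_aux hf) (S + Λ)).subset fun T hT h => hT ?_
      dsimp only at h ⊢
      rw [h, dmul_map_zero]
  rw [eta, finsum_congr h1, ← MultiIdx.finsum_antidiagonal F hF, finsum_eq_single _ 0]
  · simp [F, MultiIdx.len_zero, MultiIdx.binom_zero_right, MultiIdx.binom_zero_left, dmul_zero]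
  · intro U hU
    have h2 : ∀ p ∈ Finset.HasAntidiagonal.antidiagonal U, F p
        = (p.1.binom p.2 • (-1 : ℝ) ^ p.2.len) • ((U.binom Λ : ℝ) • J.dmul U (f (U + Λ))) := by
      intro p hp
      rw [Finset.HasAntidiagonal.mem_antidiagonal] at hp
      simp only [F]
      rw [hp, smul_smul, nsmul_eq_mul]
      congr 1
      ring
    rw [Finset.sum_congr rfl h2, ← Finset.sum_smul, MultiIdx.sum_antidiagonal_neg_one_pow,
      if_neg hU, zero_smul]

/-- The adjoint of the adjoint is the original operator. This is how Δ is recovered from the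
coefficients η(Δ) of the gauge symmetry. -/
theorem finsum_dmul_eta_mul (w : P) {f : MultiIdx n → P} (hf : (Function.support f).Finite) :
    ∑ᶠ X : MultiIdx n, (-1 : ℝ) ^ X.len • J.dmul X (J.eta f X * w) = ∑ᶠ S, f S * J.dmul S w := by
  rw [J.finsum_dmul_mul_right w (J.finite_support_eta hf), J.eta_eta hf]

/-- The variational derivative. -/
def varDeriv (v : G) (f : P) : P :=
  ∑ᶠ Λ : MultiIdx n, (-1 : ℝ) ^ Λ.len • J.dmul Λ (J.lderiv v Λ f)

theorem finite_support_lderiv (v : G) (f : P) :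
    (Function.support fun Λ => J.lderiv v Λ f).Finite :=
  (J.finite_lderiv_ne_zero f).preimage (Prod.mk_right_injective v).injOn

theorem finite_support_varDeriv (v : G) (f : P) :
    (Function.support fun Λ : MultiIdx n => (-1 : ℝ) ^ Λ.len • J.dmul Λ (J.lderiv v Λ f)).Finite :=
  (J.finite_support_lderiv v f).subset fun Λ hΛ h => hΛ (by
    dsimp only at h ⊢
    rw [h, dmul_map_zero, smul_zero])

/-- The variational derivative as a linear map. -/
def varDerivLin (v : G) : P →ₗ[ℝ] P where
  toFun := J.varDeriv v
  map_add' f g := by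
    simp only [varDeriv, map_add, dmul_add, smul_add]
    exact finsum_add_distrib (J.finite_support_varDeriv v f) (J.finite_support_varDeriv v g)
  map_smul' c f := by
    simp only [varDeriv, map_smul, dmul_smul, RingHom.id_apply]
    rw [smul_finsum]
    exact finsum_congr fun Λ => smul_comm _ _ _

theorem varDerivLin_apply (v : G) (f : P) : J.varDerivLin v f = J.varDeriv v f := rfl

/-- By the commutator formula each summand splits into d_{Λ+l} ∂^Λ and d_Λ ∂^{Λ-l}; after shifting Λ
by `l` in the second sum the two agree up to opposite signs. -/
theorem varDeriv_dtot (v : G) (l : Fin n) (f : P) : J.varDeriv v (J.dtot l f) = 0 := by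
  have h1 : ∀ Λ : MultiIdx n, (-1 : ℝ) ^ Λ.len • J.dmul Λ (J.lderiv v Λ (J.dtot l f))
      = -((-1 : ℝ) ^ (Λ + Finsupp.single l 1 : MultiIdx n).len
          • J.dmul (Λ + Finsupp.single l 1) (J.lderiv v Λ f))
        + (-1 : ℝ) ^ Λ.len • J.dmul Λ
          (if Λ l = 0 then 0 else J.lderiv v (Λ - Finsupp.single l 1) f) := by
    intro Λ
    rw [lderiv_dtot, dmul_add, smul_add, dmul_dtot, dmul_add_single, MultiIdx.len_add,
      MultiIdx.len_single, pow_succ, mul_neg_one, neg_smul, neg_neg]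
  have hA : (Function.support fun Λ : MultiIdx n =>
      (-1 : ℝ) ^ (Λ + Finsupp.single l 1 : MultiIdx n).len
          • J.dmul (Λ + Finsupp.single l 1) (J.lderiv v Λ f)).Finite :=
    (J.finite_support_lderiv v f).subset fun Λ hΛ h => hΛ (by
      dsimp only at h ⊢
      rw [h, dmul_map_zero, smul_zero])
  have hB : (Function.support fun Λ : MultiIdx n => (-1 : ℝ) ^ Λ.len • J.dmul Λ
      (if Λ l = 0 then 0 else J.lderiv v (Λ - Finsupp.single l 1) f)).Finite := by
    refine ((J.finite_support_lderiv v f).image (· + Finsupp.single l 1)).subset fun Λ hΛ => ?_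
    by_contra h
    refine hΛ ?_
    dsimp only
    split_ifs with hl
    · rw [dmul_map_zero, smul_zero]
    · obtain ⟨S, rfl⟩ := MultiIdx.exists_eq_add_single hl
      rw [add_tsub_cancel_right]
      have : J.lderiv v S f = 0 := by_contra fun h' => h ⟨S, h', rfl⟩
      rw [this, dmul_map_zero, smul_zero]
  rw [varDeriv, finsum_congr h1, finsum_add_distrib (hA.subset fun Λ hΛ h => hΛ (by
      dsimp only at h ⊢
      rw [h, neg_zero])) hB,
    finsum_neg_distrib, finsum_eq_finsum_add_single l (fun Λ => (-1 : ℝ) ^ Λ.len • J.dmul Λ _)]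
  · simp
  · intro Λ hΛ
    rw [if_pos hΛ, dmul_map_zero, smul_zero]

/-! ### Integration by parts modulo exact densities. -/

/-- The coefficients of the `d_H`-exact densities. -/
def exact : Submodule ℝ P where
  carrier := {f | ∃ σ : Fin n → P, f = ∑ l, J.dtot l (σ l)}
  zero_mem' := ⟨0, by simp [dtot_map_zero]⟩
  add_mem' := by
    rintro _ _ ⟨σ, rfl⟩ ⟨σ', rfl⟩
    exact ⟨σ + σ', by simp [dtot_add, Finset.sum_add_distrib]⟩
  smul_mem' := by
    rintro c _ ⟨σ, rfl⟩
    exact ⟨c • σ, by simp [dtot_smul, Finset.smul_sum]⟩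

theorem dtot_mem_exact (l : Fin n) (f : P) : J.dtot l f ∈ J.exact := by
  classical
  refine ⟨Pi.single l f, ?_⟩
  rw [Finset.sum_eq_single l, Pi.single_eq_same]
  · intro m _ hm
    rw [Pi.single_eq_of_ne hm, dtot_map_zero]
  · simp

theorem varDeriv_eq_zero_of_mem_exact (v : G) {f : P} (hf : f ∈ J.exact) : J.varDeriv v f = 0 := by
  obtain ⟨σ, rfl⟩ := hf
  rw [← varDerivLin_apply, map_sum]
  exact Finset.sum_eq_zero fun l _ => J.varDeriv_dtot v l _

/-- Integration by parts. -/
theorem mk_mul_dmul (f : P) (S : MultiIdx n) (g : P) :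
    J.exact.mkQ (f * J.dmul S g) = J.exact.mkQ ((-1 : ℝ) ^ S.len • J.dmul S f * g) := by
  induction S using MultiIdx.induction_add_single generalizing f with
  | zero => simp [dmul_zero, MultiIdx.len_zero]
  | add U l ih =>
    have h : J.exact.mkQ (J.dtot l (f * J.dmul U g)) = 0 :=
      (Submodule.Quotient.mk_eq_zero _).2 (J.dtot_mem_exact l _)
    rw [dtot_mul, map_add, ih] at h
    rw [dmul_add_single, dmul_add_single, eq_neg_of_add_eq_zero_right h, ← map_neg, dmul_dtot,
      MultiIdx.len_add, MultiIdx.len_single, pow_succ, mul_neg_one, neg_smul, neg_mul]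

/-- Since v_S = d_S v, all derivatives on `v` can be moved to the coefficients. Modulo exact terms,
an expression linear in the jets of `v` becomes a multiple of `v` itself. -/
theorem mk_finsum_mul_jet (v : G) {f : MultiIdx n → P} (hf : (Function.support f).Finite) :
    J.exact.mkQ (∑ᶠ S, f S * J.jet v S)
      = J.exact.mkQ ((∑ᶠ S : MultiIdx n, (-1 : ℝ) ^ S.len • J.dmul S (f S)) * J.jet v 0) := by
  have h1 : (Function.support fun S => f S * J.jet v S).Finite :=
    hf.subset fun S hS h => hS (by dsimp only; rw [h, zero_mul])
  have h2 : (Function.support fun S : MultiIdx n => (-1 : ℝ) ^ S.len • J.dmul S (f S)).Finite :=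
    hf.subset fun S hS h => hS (by dsimp only; rw [h, dmul_map_zero, smul_zero])
  rw [LinearMap.map_finsum_of_finite _ h1, finsum_mul' _ _ h2, LinearMap.map_finsum_of_finite]
  · refine finsum_congr fun S => ?_
    rw [← mk_mul_dmul, dmul_jet, zero_add]
  · exact h2.subset fun S hS h => hS (by dsimp only at h ⊢; rw [h, zero_mul])

/-! ### Independence of a generator, and expressions linear in its jets. -/

/-- `f` does not depend on the jets of `v`. -/
def Indep (v : G) (f : P) : Prop := ∀ Λ, J.lderiv v Λ f = 0

variable {J} {v : G}

theorem Indep.add {f g : P} (hf : J.Indep v f) (hg : J.Indep v g) : J.Indep v (f + g) :=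
  fun Λ => by rw [map_add, hf, hg, add_zero]

theorem Indep.smul (c : ℝ) {f : P} (hf : J.Indep v f) : J.Indep v (c • f) :=
  fun Λ => by rw [map_smul, hf, smul_zero]

theorem Indep.mul {f g : P} (hf : J.Indep v f) (hg : J.Indep v g) : J.Indep v (f * g) :=
  fun Λ => by rw [lderiv_mul', hf, hg, zero_mul, mul_zero, add_zero]

theorem Indep.sum {ι : Type*} {s : Finset ι} {f : ι → P} (hf : ∀ i, J.Indep v (f i)) :
    J.Indep v (∑ i ∈ s, f i) :=
  fun Λ => by rw [map_sum]; exact Finset.sum_eq_zero fun i _ => hf i Λ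

theorem Indep.finsum {ι : Type*} {f : ι → P} (hf : ∀ i, J.Indep v (f i)) :
    J.Indep v (∑ᶠ i, f i) :=
  finsum_induction (J.Indep v ·) (fun _ => map_zero _) (fun _ _ => Indep.add) hf

theorem Indep.lderiv {f : P} (hf : J.Indep v f) (w : G) (S : MultiIdx n) :
    J.Indep v (J.lderiv w S f) :=
  fun Λ => by rw [J.lderiv_comm, hf, map_zero, smul_zero]

theorem Indep.dtot {f : P} (hf : J.Indep v f) (l : Fin n) : J.Indep v (J.dtot l f) :=
  fun Λ => by rw [lderiv_dtot, hf, hf, dtot_map_zero, ite_self, add_zero]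

theorem Indep.dmul {f : P} (hf : J.Indep v f) (S : MultiIdx n) : J.Indep v (J.dmul S f) := by
  induction S using MultiIdx.induction_add_single with
  | zero => rwa [dmul_zero]
  | add U l ih =>
    rw [dmul_add_single]
    exact ih.dtot l

theorem Indep.eta {f : MultiIdx n → P} (hf : ∀ S, J.Indep v (f S)) (Λ : MultiIdx n) :
    J.Indep v (J.eta f Λ) :=
  Indep.finsum fun S => ((hf _).dmul S).smul _

theorem indep_jet {w : G} (h : w ≠ v) (S : MultiIdx n) : J.Indep v (J.jet w S) :=
  fun _ => J.lderiv_jet_of_ne _ _ _ _ fun h' => h (Prod.mk.inj h').1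

theorem Indep.varDeriv {f : P} (hf : J.Indep v f) (w : G) : J.Indep v (J.varDeriv w f) :=
  Indep.finsum fun S => ((hf.lderiv w S).dmul S).smul _

theorem HasParity.varDeriv {f : P} (hf : J.HasParity f 0) (w : G) :
    J.HasParity (J.varDeriv w f) (J.par w) := by
  refine HasParity.finsum fun S => ((?_ : J.HasParity _ _).dmul S).smul _
  simpa using hf.lderiv w S

theorem lderiv_jet_mul {g : P} (hg : J.Indep v g) (Λ : MultiIdx n) :
    J.lderiv v Λ (J.jet v Λ * g) = g := by
  rw [lderiv_mul', hg, mul_zero, add_zero, J.lderiv_jet_self, one_mul]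

theorem lderiv_jet_mul_of_ne {w : G} {Λ S : MultiIdx n} {g : P} (hg : J.Indep v g)
    (h : (w, S) ≠ (v, Λ)) : J.lderiv v Λ (J.jet w S * g) = 0 := by
  rw [lderiv_mul', hg, mul_zero, add_zero, J.lderiv_jet_of_ne _ _ _ _ h, zero_mul]

theorem varDeriv_jet_mul {g : P} (hg : J.Indep v g) (Λ : MultiIdx n) :
    J.varDeriv v (J.jet v Λ * g) = (-1 : ℝ) ^ Λ.len • J.dmul Λ g := by
  rw [JetCalculus.varDeriv, finsum_eq_single _ Λ, lderiv_jet_mul hg]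
  intro S hS
  rw [lderiv_jet_mul_of_ne hg (by simpa using hS.symm), dmul_map_zero, smul_zero]

theorem varDeriv_eq_zero {f : P} (hf : J.Indep v f) : J.varDeriv v f = 0 :=
  finsum_eq_zero_of_forall_eq_zero fun Λ => by rw [hf, dmul_map_zero, smul_zero]

/-- The variational derivative of `∑ v_Λ g^Λ` with respect to `v`. -/
theorem varDeriv_finsum_jet_mul {g : MultiIdx n → P} (hg : ∀ Λ, J.Indep v (g Λ))
    (hf : (Function.support g).Finite) :
    J.varDeriv v (∑ᶠ Λ, J.jet v Λ * g Λ) = ∑ᶠ Λ : MultiIdx n, (-1 : ℝ) ^ Λ.len • J.dmul Λ (g Λ) := by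
  rw [← varDerivLin_apply, LinearMap.map_finsum_of_finite]
  · exact finsum_congr fun Λ => varDeriv_jet_mul (hg Λ) Λ
  · exact hf.subset fun S hS h => hS (by dsimp only; rw [h, mul_zero])

theorem lderiv_finsum_jet_mul {g : MultiIdx n → P} (hg : ∀ Λ, J.Indep v (g Λ))
    (hf : (Function.support g).Finite) (S : MultiIdx n) :
    J.lderiv v S (∑ᶠ Λ, J.jet v Λ * g Λ) = g S := by
  rw [LinearMap.map_finsum_of_finite, finsum_eq_single _ S, lderiv_jet_mul (hg S)]
  · exact fun Λ hΛ => lderiv_jet_mul_of_ne (hg Λ) (by simpa using hΛ)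
  · exact hf.subset fun S hS h => hS (by dsimp only; rw [h, mul_zero])

end JetCalculus

/-! ### Iterated finite sums with jointly finite support. -/

theorem finite_support_uncurry {A B P : Type*} [Zero P] {F : A → B → P} {s : Set A}
    (hs : s.Finite) (h0 : ∀ a ∉ s, ∀ b, F a b = 0) (hF : ∀ a, (Function.support (F a)).Finite) :
    (Function.support fun p : A × B => F p.1 p.2).Finite := by
  refine (hs.biUnion fun a _ => (hF a).image (Prod.mk a)).subset ?_
  rintro ⟨a, b⟩ hab
  refine Set.mem_biUnion (x := a) (by_contra fun h => hab (h0 a h b)) ⟨b, hab, rfl⟩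

theorem finsum_finsum_comm {A B P : Type*} [AddCommMonoid P] {F : A → B → P}
    (hF : (Function.support fun p : A × B => F p.1 p.2).Finite) :
    ∑ᶠ a, ∑ᶠ b, F a b = ∑ᶠ b, ∑ᶠ a, F a b := by
  have h1 := finsum_curry (fun p : A × B => F p.1 p.2) hF
  have h2 := finsum_curry (fun p : B × A => F p.2 p.1)
    (hF.preimage (f := Prod.swap) Prod.swap_injective.injOn)
  rw [← h1, ← h2, ← finsum_comp_equiv (Equiv.prodComm A B)]
  rfl

theorem LinearMap.map_finsum_finsum {R A B P Q : Type*} [Semiring R] [AddCommMonoid P]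
    [AddCommMonoid Q] [Module R P] [Module R Q] (L : P →ₗ[R] Q) {F : A → B → P}
    (hF : (Function.support fun p : A × B => F p.1 p.2).Finite) :
    L (∑ᶠ a, ∑ᶠ b, F a b) = ∑ᶠ a, ∑ᶠ b, L (F a b) := by
  have h : (Function.support fun p : A × B => L (F p.1 p.2)).Finite :=
    hF.subset fun p hp h => hp (by dsimp only at h ⊢; rw [h, map_zero])
  rw [← finsum_curry (fun p : A × B => F p.1 p.2) hF, L.map_finsum_of_finite hF,
    finsum_curry (fun p : A × B => L (F p.1 p.2)) h]

theorem finsum_finsum_add_distrib {A B P : Type*} [AddCommMonoid P] {F F' : A → B → P}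
    (hF : (Function.support fun p : A × B => F p.1 p.2).Finite)
    (hF' : (Function.support fun p : A × B => F' p.1 p.2).Finite) :
    ∑ᶠ a, ∑ᶠ b, (F a b + F' a b) = ∑ᶠ a, ∑ᶠ b, F a b + ∑ᶠ a, ∑ᶠ b, F' a b := by
  rw [← finsum_curry (fun p : A × B => F p.1 p.2) hF,
    ← finsum_curry (fun p : A × B => F' p.1 p.2) hF', ← finsum_add_distrib hF hF',
    finsum_curry (fun p : A × B => F p.1 p.2 + F' p.1 p.2)]
  exact (hF.union hF').subset (Function.support_add _ _)

/-! ### Right derivatives in the abstract calculus. -/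

namespace JetCalculus

variable {G : Type} {n : ℕ} {P : Type} [Ring P] [Algebra ℝ P] (J : JetCalculus G n P)

theorem eta_eq_zero {f : MultiIdx n → P} (hf : ∀ S, f S = 0) (S : MultiIdx n) : J.eta f S = 0 :=
  finsum_eq_zero_of_forall_eq_zero fun T => by rw [hf, dmul_map_zero, smul_zero]

theorem finite_support_eta_uncurry {A : Type*} {F : A → MultiIdx n → P}
    (hF : (Function.support fun p : A × MultiIdx n => F p.1 p.2).Finite) :
    (Function.support fun p : A × MultiIdx n => J.eta (F p.1) p.2).Finite := by
  refine finite_support_uncurry (hF.image Prod.fst) (fun a ha b => J.eta_eq_zero (fun S => ?_) b)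
    fun a => J.finite_support_eta (f := F a)
      (finite_support_slice (F := fun p : A × MultiIdx n => F p.1 p.2) hF a)
  exact by_contra fun h => ha ⟨(a, S), h, rfl⟩

/-- The right partial derivative. -/
def rderiv (v : G) (Λ : MultiIdx n) (f : P) : P := J.tauPow (J.par v) (J.lderiv v Λ f)

theorem tauPow_dtot (p : ZMod 2) (l : Fin n) (f : P) :
    J.tauPow p (J.dtot l f) = J.dtot l (J.tauPow p f) := by
  rw [tauPow_apply, tauPow_apply]
  split_ifs
  · rfl
  · exact J.tau_dtot l f

theorem rderiv_dtot (v : G) (Λ : MultiIdx n) (l : Fin n) (f : P) :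
    J.rderiv v Λ (J.dtot l f) = J.dtot l (J.rderiv v Λ f)
      + if Λ l = 0 then 0 else J.rderiv v (Λ - Finsupp.single l 1) f := by
  rw [rderiv, lderiv_dtot, map_add, tauPow_dtot]
  split_ifs
  · rw [map_zero]
    rfl
  · rfl

theorem rderiv_mul (v : G) (Λ : MultiIdx n) (f g : P) : J.rderiv v Λ (f * g)
    = f * J.rderiv v Λ g + J.rderiv v Λ f * J.tauPow (J.par v) g := by
  rw [rderiv, lderiv_mul', map_add, map_mul, map_mul, tauPow_tauPow, add_comm]
  rfl

theorem rderiv_jet_self (v : G) (Λ : MultiIdx n) : J.rderiv v Λ (J.jet v Λ) = 1 := by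
  rw [rderiv, J.lderiv_jet_self, map_one]

theorem rderiv_jet_of_ne {v w : G} {Λ S : MultiIdx n} (h : (w, S) ≠ (v, Λ)) :
    J.rderiv v Λ (J.jet w S) = 0 := by
  rw [rderiv, J.lderiv_jet_of_ne _ _ _ _ h, map_zero]

theorem finite_support_rderiv (v : G) (f : P) :
    (Function.support fun Λ => J.rderiv v Λ f).Finite :=
  (J.finite_support_lderiv v f).subset fun Λ hΛ h => hΛ (by
    dsimp only at h ⊢
    rw [rderiv, h, map_zero])

variable {J} in
theorem Indep.rderiv_eq_zero {v : G} {f : P} (hf : J.Indep v f) (Λ : MultiIdx n) :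
    J.rderiv v Λ f = 0 := by
  rw [rderiv, hf, map_zero]

end JetCalculus

/-! ### Noether operators and the derivation δ̄ in the abstract calculus. -/

/-- The coefficients of a hierarchy of Noether operators in a jet calculus, together with the
variational derivatives `EL` of a Lagrangian. -/
structure NoetherOps (M : FieldChart) {P : Type} [Ring P] [Algebra ℝ P]
    (J : JetCalculus M.Gen M.n P) where
  par_eq : ∀ v, J.par v = v.parity
  EL : M.R 0 → P
  EL_par : ∀ A, J.HasParity (EL A) (M.par 0 A)
  EL_indep : ∀ A v, (∀ B, v ≠ .field 0 B) → J.Indep v (EL A)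
  Δ : (k : ℕ) → M.R (k + 1) → M.R k → MultiIdx M.n → P
  Δ_fin : ∀ k r r', (Function.support (Δ k r r')).Finite
  Δ_indep : ∀ k r r' Λ v, (∀ B, v ≠ .field 0 B) → J.Indep v (Δ k r r' Λ)
  h : (k : ℕ) → M.R (k + 2) → M.R k → M.R 0 → MultiIdx M.n → MultiIdx M.n → P
  h_par : ∀ k r r' A S X,
    J.HasParity (h k r r' A S X) (M.par (k + 2) r + M.par k r' + M.par 0 A)
  h_fin : ∀ k r r' A,
    (Function.support fun q : MultiIdx M.n × MultiIdx M.n => h k r r' A q.1 q.2).Finite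
  h_indep : ∀ k r r' A S X v, (∀ B, v ≠ .field 0 B) → J.Indep v (h k r r' A S X)

namespace NoetherOps

open FieldChart

variable {M : FieldChart} {P : Type} [Ring P] [Algebra ℝ P] {J : JetCalculus M.Gen M.n P}
  (D : NoetherOps M J)

/-- The right derivation which takes the jets of the field antifields to those of `EL`. -/
def deltaBar (f : P) : P :=
  ∑ A : M.R 0, ∑ᶠ Λ : MultiIdx M.n, J.rderiv (.anti 0 A) Λ f * J.dmul Λ (D.EL A)

/-- The linear part of the Noether operator of stage `k`. -/
def linPart (k : ℕ) (r : M.R (k + 1)) : P :=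
  ∑ r' : M.R k, ∑ᶠ Λ : MultiIdx M.n, D.Δ k r r' Λ * J.jet (.anti k r') Λ

/-- The part of the Noether operator which is quadratic in the antifields. -/
def quadPart (k : ℕ) (r : M.R (k + 2)) : P :=
  ∑ r' : M.R k, ∑ A : M.R 0, ∑ᶠ S : MultiIdx M.n, ∑ᶠ X : MultiIdx M.n,
    D.h k r r' A S X * J.jet (.anti k r') S * J.jet (.anti 0 A) X

/-- The components of the gauge symmetry of stage `k`. -/
def u (k : ℕ) (r' : M.R k) : P :=
  ∑ r : M.R (k + 1), ∑ᶠ Λ : MultiIdx M.n, J.jet (.field (k + 1) r) Λ * J.eta (D.Δ k r r') Λ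

/-- The coefficients of the right derivative of `quadPart` along the field antifields. -/
def hsym : (k : ℕ) → M.R (k + 2) → M.R k → M.R 0 → MultiIdx M.n → MultiIdx M.n → P
  | 0, r, B, A, S, X =>
      D.h 0 r B A S X + gsign ((M.par 0 A + 1) * (M.par 0 B + 1)) • D.h 0 r A B X S
  | k + 1, r, r', A, S, X => D.h (k + 1) r r' A S X

/-- The antifield term of the gauge symmetry condition. -/
def alpha (k : ℕ) (r' : M.R k) : P :=
  - ∑ r : M.R (k + 2), ∑ A : M.R 0, ∑ᶠ X : MultiIdx M.n, ∑ᶠ S : MultiIdx M.n,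
      gsign ((M.par (k + 2) r + M.par k r' + M.par 0 A) * M.par (k + 2) r
          + (M.par k r' + 1) * M.par 0 A) •
        (J.eta (fun S' => D.hsym k r r' A S' X) S *
          J.dmul S (J.jet (.field (k + 2) r) 0 * J.jet (.anti 0 A) X))

/-- The gauge symmetry condition of stage `k + 1`. -/
def GaugeCondition (k : ℕ) : Prop :=
  ∀ r' : M.R k,
    (∑ r : M.R (k + 1), ∑ᶠ S : MultiIdx M.n,
        J.dmul S (D.u (k + 1) r) * J.lderiv (.field (k + 1) r) S (D.u k r'))
      = D.deltaBar (D.alpha k r')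

/-- The density obtained from the gauge symmetry condition of stage `k + 1`. -/
def symDensity (k : ℕ) : P :=
  (∑ r : M.R (k + 2), ∑ r' : M.R k, ∑ A : M.R 0, ∑ᶠ X : MultiIdx M.n, ∑ᶠ S : MultiIdx M.n,
      J.jet (.field (k + 2) r) 0 * D.hsym k r r' A S X * J.jet (.anti k r') S
        * J.dmul X (D.EL A))
    + ∑ r : M.R (k + 1), D.u (k + 1) r * D.linPart k r

/-- The composition of the linear parts of the Noether operators of two stages. -/
def noetherLHS (k : ℕ) (r : M.R (k + 2)) : P :=
  ∑ r' : M.R (k + 1), ∑ᶠ Λ : MultiIdx M.n, D.Δ (k + 1) r r' Λ * J.dmul Λ (D.linPart k r')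

/-! ### The derivation `deltaBar` -/

theorem finite_support_deltaBar (A : M.R 0) (f : P) : (Function.support fun Λ : MultiIdx M.n =>
    J.rderiv (.anti 0 A) Λ f * J.dmul Λ (D.EL A)).Finite :=
  (J.finite_support_rderiv (.anti 0 A) f).subset fun Λ hΛ h => hΛ (by
    dsimp only at h ⊢
    rw [h, zero_mul])

/-- `deltaBar` as a linear map. -/
def deltaBarLin : P →ₗ[ℝ] P where
  toFun := D.deltaBar
  map_add' f g := by
    rw [deltaBar, deltaBar, deltaBar, ← Finset.sum_add_distrib]
    refine Finset.sum_congr rfl fun A _ => ?_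
    rw [← finsum_add_distrib (D.finite_support_deltaBar A f) (D.finite_support_deltaBar A g)]
    simp only [JetCalculus.rderiv, map_add, add_mul]
  map_smul' c f := by
    rw [deltaBar, deltaBar, RingHom.id_apply, Finset.smul_sum]
    refine Finset.sum_congr rfl fun A _ => ?_
    rw [smul_finsum]
    simp only [JetCalculus.rderiv, map_smul, smul_mul_assoc]

theorem deltaBarLin_apply (f : P) : D.deltaBarLin f = D.deltaBar f := rfl

/-- The values assigned to the jets of an antifield are themselves the total derivatives of one
function. The commutator term ∂^{Λ-l}, once shifted, therefore supplies exactly the terms with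
d_{Λ+l} 𝓔_A. -/
theorem deltaBar_dtot (l : Fin M.n) (f : P) : D.deltaBar (J.dtot l f) = J.dtot l (D.deltaBar f) := by
  rw [deltaBar, deltaBar]
  refine Eq.trans ?_ (map_sum (J.dtotLin l) _ _).symm
  refine Finset.sum_congr rfl fun A _ => ?_
  rw [LinearMap.map_finsum_of_finite _ (D.finite_support_deltaBar A f)]
  have hA : (Function.support fun Λ : MultiIdx M.n =>
      J.dtot l (J.rderiv (.anti 0 A) Λ f) * J.dmul Λ (D.EL A)).Finite :=
    (J.finite_support_rderiv (.anti 0 A) f).subset fun Λ hΛ h => hΛ (by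
      dsimp only at h ⊢
      rw [h, JetCalculus.dtot_map_zero, zero_mul])
  have hC : (Function.support fun Λ : MultiIdx M.n =>
      J.rderiv (.anti 0 A) Λ f * J.dmul (Λ + Finsupp.single l 1) (D.EL A)).Finite :=
    (J.finite_support_rderiv (.anti 0 A) f).subset fun Λ hΛ h => hΛ (by
      dsimp only at h ⊢
      rw [h, zero_mul])
  have hB : (Function.support fun Λ : MultiIdx M.n =>
      (if Λ l = 0 then 0 else J.rderiv (.anti 0 A) (Λ - Finsupp.single l 1) f)
        * J.dmul Λ (D.EL A)).Finite := by
    refine ((J.finite_support_rderiv (.anti 0 A) f).image (· + Finsupp.single l 1)).subset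
      fun Λ hΛ => ?_
    by_contra h
    refine hΛ ?_
    dsimp only
    split_ifs with hl
    · rw [zero_mul]
    · obtain ⟨S, rfl⟩ := MultiIdx.exists_eq_add_single hl
      rw [add_tsub_cancel_right]
      have : J.rderiv (.anti 0 A) S f = 0 := by_contra fun h' => h ⟨S, h', rfl⟩
      rw [this, zero_mul]
  simp only [JetCalculus.rderiv_dtot, add_mul, JetCalculus.dtotLin_apply, JetCalculus.dtot_mul]
  rw [finsum_add_distrib hA hB, finsum_eq_finsum_add_single l (fun Λ : MultiIdx M.n =>
      (if Λ l = 0 then 0 else J.rderiv (.anti 0 A) (Λ - Finsupp.single l 1) f)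
        * J.dmul Λ (D.EL A)) fun Λ hΛ => by rw [if_pos hΛ, zero_mul]]
  simp only [← JetCalculus.dmul_add_single]
  rw [finsum_add_distrib hA hC]
  simp

theorem deltaBar_dmul (S : MultiIdx M.n) (f : P) :
    D.deltaBar (J.dmul S f) = J.dmul S (D.deltaBar f) := by
  induction S using MultiIdx.induction_add_single with
  | zero => simp only [JetCalculus.dmul_zero]
  | add U l ih => rw [JetCalculus.dmul_add_single, deltaBar_dtot, ih, JetCalculus.dmul_add_single]

/-- A right derivation differentiates the right factor without a sign, so a left factor free of
field antifields simply comes out. -/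
theorem deltaBar_mul_of_indep {f : P} (hf : ∀ A, J.Indep (.anti 0 A) f) (g : P) :
    D.deltaBar (f * g) = f * D.deltaBar g := by
  rw [deltaBar, deltaBar, Finset.mul_sum]
  refine Finset.sum_congr rfl fun A _ => ?_
  rw [mul_finsum' _ _ (D.finite_support_deltaBar A g)]
  refine finsum_congr fun Λ => ?_
  rw [JetCalculus.rderiv_mul, (hf A).rderiv_eq_zero, zero_mul, add_zero, mul_assoc]

/-- When the right derivative reaches the left factor it has passed through `g`, hence the twist of
`g` by the parity of the antifield. -/
theorem deltaBar_jet_mul (A : M.R 0) (X : MultiIdx M.n) (g : P) :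
    D.deltaBar (J.jet (.anti 0 A) X * g) = J.jet (.anti 0 A) X * D.deltaBar g
      + J.tauPow (M.par 0 A + 1) g * J.dmul X (D.EL A) := by
  classical
  have h1 : ∀ B : M.R 0, ∑ᶠ Λ : MultiIdx M.n,
      J.rderiv (.anti 0 B) Λ (J.jet (.anti 0 A) X * g) * J.dmul Λ (D.EL B)
      = J.jet (.anti 0 A) X * ∑ᶠ Λ : MultiIdx M.n, J.rderiv (.anti 0 B) Λ g * J.dmul Λ (D.EL B)
        + if B = A then J.tauPow (M.par 0 A + 1) g * J.dmul X (D.EL A) else 0 := by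
    intro B
    rw [mul_finsum' _ _ (D.finite_support_deltaBar B g)]
    have hz : ∀ Λ, Λ ≠ X ∨ B ≠ A → J.rderiv (.anti 0 B) Λ (J.jet (.anti 0 A) X) = 0 := by
      intro Λ h
      refine J.rderiv_jet_of_ne fun h' => ?_
      simp only [Prod.mk.injEq, Gen.anti.injEq, true_and, heq_eq_eq] at h'
      rcases h with h | h
      · exact h h'.2.symm
      · exact h h'.1.symm
    have hs : (if B = A then J.tauPow (M.par 0 A + 1) g * J.dmul X (D.EL A) else 0)
        = ∑ᶠ Λ : MultiIdx M.n, J.rderiv (.anti 0 B) Λ (J.jet (.anti 0 A) X)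
            * J.tauPow (J.par (.anti 0 B)) g * J.dmul Λ (D.EL B) := by
      rw [finsum_eq_single _ X fun Λ h => by rw [hz Λ (Or.inl h), zero_mul, zero_mul]]
      split_ifs with h
      · subst h
        rw [J.rderiv_jet_self, one_mul, D.par_eq]
        rfl
      · rw [hz X (Or.inr h), zero_mul, zero_mul]
    rw [hs, ← finsum_add_distrib]
    · refine finsum_congr fun Λ => ?_
      rw [JetCalculus.rderiv_mul, add_mul, mul_assoc]
    · exact (D.finite_support_deltaBar B g).subset fun Λ hΛ h => hΛ (by
        dsimp only at h ⊢
        rw [h, mul_zero])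
    · refine (Set.finite_singleton X).subset fun Λ hΛ => by_contra fun h => hΛ ?_
      dsimp only
      rw [hz Λ (Or.inl h), zero_mul, zero_mul]
  rw [deltaBar, Finset.sum_congr rfl fun B _ => h1 B, Finset.sum_add_distrib, ← Finset.mul_sum]
  simp [deltaBar]

theorem deltaBar_one : D.deltaBar 1 = 0 := by
  have h : ∀ A, J.Indep (.anti 0 A) (1 : P) := fun A Λ => by
    have := J.lderiv_mul' (.anti 0 A) Λ 1 1
    rw [mul_one, mul_one, map_one (J.tauPow _), one_mul] at this
    exact left_eq_add.1 this
  refine Finset.sum_eq_zero fun A _ => finsum_eq_zero_of_forall_eq_zero fun Λ => ?_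
  rw [(h A).rderiv_eq_zero, zero_mul]

theorem deltaBar_jet (A : M.R 0) (X : MultiIdx M.n) :
    D.deltaBar (J.jet (.anti 0 A) X) = J.dmul X (D.EL A) := by
  have := D.deltaBar_jet_mul A X 1
  rwa [mul_one, deltaBar_one, mul_zero, zero_add, map_one, one_mul] at this

/-! ### The coefficients `hsym` -/

theorem hsym_par : ∀ k r r' A S X,
    J.HasParity (D.hsym k r r' A S X) (M.par (k + 2) r + M.par k r' + M.par 0 A)
  | 0, r, B, A, S, X => (D.h_par 0 r B A S X).add <| by
      have := (D.h_par 0 r A B X S).smul (gsign ((M.par 0 A + 1) * (M.par 0 B + 1)))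
      rwa [add_right_comm] at this
  | k + 1, r, r', A, S, X => D.h_par (k + 1) r r' A S X

theorem hsym_indep : ∀ k r r' A S X v, (∀ B, v ≠ .field 0 B) → J.Indep v (D.hsym k r r' A S X)
  | 0, r, B, A, S, X, v, hv =>
      (D.h_indep 0 r B A S X v hv).add ((D.h_indep 0 r A B X S v hv).smul _)
  | k + 1, r, r', A, S, X, v, hv => D.h_indep (k + 1) r r' A S X v hv

theorem h_fin_swap (k : ℕ) (r : M.R (k + 2)) (r' : M.R k) (A : M.R 0) :
    (Function.support fun q : MultiIdx M.n × MultiIdx M.n => D.h k r r' A q.2 q.1).Finite :=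
  (D.h_fin k r r' A).preimage (f := Prod.swap) Prod.swap_injective.injOn

theorem hsym_fin : ∀ k r r' A, (Function.support fun q : MultiIdx M.n × MultiIdx M.n =>
    D.hsym k r r' A q.2 q.1).Finite
  | 0, r, B, A => by
      refine ((D.h_fin_swap 0 r B A).union (D.h_fin 0 r A B)).subset fun q hq => ?_
      by_contra h
      rw [Set.mem_union, not_or, Function.notMem_support, Function.notMem_support] at h
      refine hq ?_
      dsimp only [hsym]
      rw [h.1, h.2, smul_zero, add_zero]
  | k + 1, r, r', A => D.h_fin_swap (k + 1) r r' A

/-- For positive index only the last antifield is hit, since the other one is a higher-stage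
antifield. For index zero both factors are field antifields, and renaming (B,S) ↔ (A,X) in the
second contribution yields the graded symmetrization in `hsym`. -/
theorem deltaBar_quadPart (k : ℕ) (r : M.R (k + 2)) : D.deltaBar (D.quadPart k r)
    = ∑ r' : M.R k, ∑ A : M.R 0, ∑ᶠ X : MultiIdx M.n, ∑ᶠ S : MultiIdx M.n,
        D.hsym k r r' A S X * J.jet (.anti k r') S * J.dmul X (D.EL A) := by
  have hfin : ∀ k r r' A {F : MultiIdx M.n × MultiIdx M.n → P},
      (∀ q, D.h k r r' A q.1 q.2 = 0 → F q = 0) → (Function.support F).Finite :=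
    fun k r r' A F hF => (D.h_fin k r r' A).subset fun q hq h => hq (hF _ h)
  have hind : ∀ k r r' A S X B, J.Indep (.anti 0 B) (D.h k r r' A S X) :=
    fun k r r' A S X B => D.h_indep k r r' A S X _ fun C => by simp
  have h1 : D.deltaBar (D.quadPart k r) = ∑ r' : M.R k, ∑ A : M.R 0, ∑ᶠ S : MultiIdx M.n,
      ∑ᶠ X : MultiIdx M.n, D.deltaBar (D.h k r r' A S X * J.jet (.anti k r') S
        * J.jet (.anti 0 A) X) := by
    rw [quadPart, ← deltaBarLin_apply, map_sum]
    refine Finset.sum_congr rfl fun r' _ => ?_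
    rw [map_sum]
    refine Finset.sum_congr rfl fun A _ => ?_
    exact D.deltaBarLin.map_finsum_finsum
      (hfin k r r' A fun q h => by rw [h, zero_mul, zero_mul])
  rw [h1]
  cases k with
  | zero =>
    have h2 : ∀ (B A : M.R 0) (S X : MultiIdx M.n),
        D.deltaBar (D.h 0 r B A S X * J.jet (.anti 0 B) S * J.jet (.anti 0 A) X)
          = D.h 0 r B A S X * J.jet (.anti 0 B) S * J.dmul X (D.EL A)
            + gsign ((M.par 0 B + 1) * (M.par 0 A + 1)) • D.h 0 r B A S X
              * J.jet (.anti 0 A) X * J.dmul S (D.EL B) := by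
      intro B A S X
      have hp : J.HasParity (J.jet (.anti 0 A) X) (M.par 0 A + 1) := by
        have := J.hasParity_jet (.anti 0 A) X
        rwa [D.par_eq] at this
      rw [mul_assoc, deltaBar_mul_of_indep _ (hind _ _ _ _ _ _), deltaBar_jet_mul, deltaBar_jet,
        hp.tauPow, mul_add, smul_mul_assoc, mul_smul_comm, smul_mul_assoc, smul_mul_assoc,
        mul_assoc, mul_assoc]
    have hadd : ∀ a b c : P, (a + b) * c = a * c + b * c := add_mul
    simp only [h2, hsym, hadd]
    have h3 : ∀ B A : M.R 0, ∑ᶠ S : MultiIdx M.n, ∑ᶠ X : MultiIdx M.n,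
        (D.h 0 r B A S X * J.jet (.anti 0 B) S * J.dmul X (D.EL A)
            + gsign ((M.par 0 B + 1) * (M.par 0 A + 1)) • D.h 0 r B A S X
              * J.jet (.anti 0 A) X * J.dmul S (D.EL B))
        = (∑ᶠ X : MultiIdx M.n, ∑ᶠ S : MultiIdx M.n,
            D.h 0 r B A S X * J.jet (.anti 0 B) S * J.dmul X (D.EL A))
          + ∑ᶠ S : MultiIdx M.n, ∑ᶠ X : MultiIdx M.n,
            gsign ((M.par 0 B + 1) * (M.par 0 A + 1)) • D.h 0 r B A S X
              * J.jet (.anti 0 A) X * J.dmul S (D.EL B) := by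
      intro B A
      rw [finsum_finsum_add_distrib (hfin 0 r B A fun q h => by rw [h, zero_mul, zero_mul])
        (hfin 0 r B A fun q h => by rw [h, smul_zero, zero_mul, zero_mul]),
        finsum_finsum_comm (hfin 0 r B A fun q h => by rw [h, zero_mul, zero_mul])]
    have h4 : ∀ B A : M.R 0, ∑ᶠ X : MultiIdx M.n, ∑ᶠ S : MultiIdx M.n,
        (D.h 0 r B A S X * J.jet (.anti 0 B) S * J.dmul X (D.EL A)
            + gsign ((M.par 0 A + 1) * (M.par 0 B + 1)) • D.h 0 r A B X S
              * J.jet (.anti 0 B) S * J.dmul X (D.EL A))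
        = (∑ᶠ X : MultiIdx M.n, ∑ᶠ S : MultiIdx M.n,
            D.h 0 r B A S X * J.jet (.anti 0 B) S * J.dmul X (D.EL A))
          + ∑ᶠ X : MultiIdx M.n, ∑ᶠ S : MultiIdx M.n,
            gsign ((M.par 0 A + 1) * (M.par 0 B + 1)) • D.h 0 r A B X S
              * J.jet (.anti 0 B) S * J.dmul X (D.EL A) := by
      intro B A
      refine finsum_finsum_add_distrib ?_ ?_
      swap
      · exact (D.h_fin 0 r A B).subset fun q hq h => hq (by
          dsimp only at h ⊢
          rw [h, smul_zero, zero_mul, zero_mul])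
      exact (D.h_fin_swap 0 r B A).subset fun q hq h => hq (by
        dsimp only at h ⊢
        rw [h, zero_mul, zero_mul])
    simp only [h3, h4, Finset.sum_add_distrib]
    congr 1
    -- Exchanging the two field indices is the whole renaming: the multi-indices are bound variables
    -- already nested in matching order.
    exact Finset.sum_comm
  | succ k =>
    refine Finset.sum_congr rfl fun r' _ => Finset.sum_congr rfl fun A _ => ?_
    rw [finsum_finsum_comm (hfin (k + 1) r r' A fun q h => by
      rw [h, zero_mul, zero_mul, ← deltaBarLin_apply, map_zero])]
    refine finsum_congr fun X => finsum_congr fun S => ?_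
    rw [deltaBar_mul_of_indep, deltaBar_jet]
    · rfl
    · exact fun B => (hind _ _ _ _ _ _ B).mul (JetCalculus.indep_jet (by simp) S)

end NoetherOps

/-! ### Exactness of the density and its variational derivative. -/

namespace NoetherOps

open FieldChart

variable {M : FieldChart} {P : Type} [Ring P] [Algebra ℝ P] {J : JetCalculus M.Gen M.n P}
  (D : NoetherOps M J)

/-- The coefficients and the ghost contain no field antifields, so δ̄ passes them and d_S without
signs and replaces the jet of s̄_A by d_X 𝓔_A. -/
theorem deltaBar_alpha (k : ℕ) (r' : M.R k) : D.deltaBar (D.alpha k r')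
    = - ∑ r : M.R (k + 2), ∑ A : M.R 0, ∑ᶠ X : MultiIdx M.n, ∑ᶠ S : MultiIdx M.n,
      gsign ((M.par (k + 2) r + M.par k r' + M.par 0 A) * M.par (k + 2) r
          + (M.par k r' + 1) * M.par 0 A) •
        (J.eta (fun S' => D.hsym k r r' A S' X) S *
          J.dmul S (J.jet (.field (k + 2) r) 0 * J.dmul X (D.EL A))) := by
  rw [alpha, ← deltaBarLin_apply, map_neg, map_sum]
  congr 1
  refine Finset.sum_congr rfl fun r _ => ?_
  rw [map_sum]
  refine Finset.sum_congr rfl fun A _ => ?_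
  rw [LinearMap.map_finsum_finsum]
  · refine finsum_congr fun X => finsum_congr fun S => ?_
    rw [map_smul, deltaBarLin_apply, deltaBar_mul_of_indep, deltaBar_dmul, deltaBar_mul_of_indep,
      deltaBar_jet]
    · exact fun B => JetCalculus.indep_jet (by simp) 0
    · exact fun B => JetCalculus.Indep.eta (fun S' => D.hsym_indep _ _ _ _ _ _ _ (by simp)) S
  · refine (J.finite_support_eta_uncurry (F := fun X S => D.hsym k r r' A S X)
      (D.hsym_fin k r r' A)).subset fun p hp h => hp ?_
    dsimp only at h ⊢
    rw [h, zero_mul, smul_zero]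

/-- The gauge symmetry is linear in the ghosts with ghost-free coefficients, and the ghost stands on
the left, so no sign arises. This identifies the gauge condition with the result of the integration
by parts in `mk_u_mul_linPart`. -/
theorem lderiv_u (k : ℕ) (r : M.R (k + 1)) (r' : M.R k) (S : MultiIdx M.n) :
    J.lderiv (.field (k + 1) r) S (D.u k r') = J.eta (D.Δ k r r') S := by
  have hind : ∀ r₂ Λ, J.Indep (.field (k + 1) r) (J.eta (D.Δ k r₂ r') Λ) := fun r₂ Λ =>
    JetCalculus.Indep.eta (fun S' => D.Δ_indep _ _ _ _ _ (by simp)) Λ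
  rw [u, map_sum, Finset.sum_eq_single r]
  · exact JetCalculus.lderiv_finsum_jet_mul (hind r) (J.finite_support_eta (D.Δ_fin k r r')) S
  · intro r₂ _ hr
    have : J.Indep (.field (k + 1) r)
        (∑ᶠ Λ : MultiIdx M.n, J.jet (.field (k + 1) r₂) Λ * J.eta (D.Δ k r₂ r') Λ) :=
      JetCalculus.Indep.finsum fun Λ => (JetCalculus.indep_jet (by simpa using hr) Λ).mul
        (hind r₂ Λ)
    exact this S
  · simp

theorem mk_ghost_term (k : ℕ) (r : M.R (k + 2)) (r' : M.R k) (A : M.R 0) :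
    J.exact.mkQ (∑ᶠ X : MultiIdx M.n, ∑ᶠ S : MultiIdx M.n,
      J.jet (.field (k + 2) r) 0 * D.hsym k r r' A S X * J.jet (.anti k r') S * J.dmul X (D.EL A))
    = J.exact.mkQ ((∑ᶠ X : MultiIdx M.n, ∑ᶠ S : MultiIdx M.n,
        gsign ((M.par (k + 2) r + M.par k r' + M.par 0 A) * M.par (k + 2) r
          + (M.par k r' + 1) * M.par 0 A) •
        (J.eta (fun S' => D.hsym k r r' A S' X) S *
          J.dmul S (J.jet (.field (k + 2) r) 0 * J.dmul X (D.EL A)))) * J.jet (.anti k r') 0) := by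
  have hX : {X : MultiIdx M.n | ∃ S, D.hsym k r r' A S X ≠ 0}.Finite :=
    ((D.hsym_fin k r r' A).image Prod.fst).subset fun X ⟨S, hS⟩ => ⟨(X, S), hS, rfl⟩
  have hX0 : ∀ X ∉ {X : MultiIdx M.n | ∃ S, D.hsym k r r' A S X ≠ 0}, ∀ S,
      D.hsym k r r' A S X = 0 := fun X hX S => by_contra fun h => hX ⟨S, h⟩
  have hslice : ∀ X, (Function.support fun S => D.hsym k r r' A S X).Finite := fun X =>
    finite_support_slice (F := fun q : MultiIdx M.n × MultiIdx M.n => D.hsym k r r' A q.2 q.1)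
      (D.hsym_fin k r r' A) X
  have hf1 : (Function.support fun X : MultiIdx M.n => ∑ᶠ S : MultiIdx M.n,
      J.jet (.field (k + 2) r) 0 * D.hsym k r r' A S X * J.jet (.anti k r') S
        * J.dmul X (D.EL A)).Finite :=
    hX.subset fun X hXs => by_contra fun h => hXs <| finsum_eq_zero_of_forall_eq_zero fun S => by
      rw [hX0 X h, mul_zero, zero_mul, zero_mul]
  have hf2 : (Function.support fun X : MultiIdx M.n => ∑ᶠ S : MultiIdx M.n,
      gsign ((M.par (k + 2) r + M.par k r' + M.par 0 A) * M.par (k + 2) r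
          + (M.par k r' + 1) * M.par 0 A) •
        (J.eta (fun S' => D.hsym k r r' A S' X) S *
          J.dmul S (J.jet (.field (k + 2) r) 0 * J.dmul X (D.EL A)))).Finite :=
    hX.subset fun X hXs => by_contra fun h => hXs <| finsum_eq_zero_of_forall_eq_zero fun S => by
      rw [J.eta_eq_zero fun S' => hX0 X h S', zero_mul, smul_zero]
  rw [J.exact.mkQ.map_finsum_of_finite hf1, finsum_mul' _ _ hf2,
    J.exact.mkQ.map_finsum_of_finite]
  swap
  · exact hf2.subset fun X hXs h => hXs (by dsimp only at h ⊢; rw [h, zero_mul])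
  refine finsum_congr fun X => ?_
  -- Before integrating by parts the ghost is moved past `hsym` and the antifield past d_X 𝓔_A.
  -- These two exchanges account for the two summands of the exponent in `alpha`.
  have hcomm : ∀ S, J.jet (.field (k + 2) r) 0 * D.hsym k r r' A S X * J.jet (.anti k r') S
      * J.dmul X (D.EL A)
      = (gsign ((M.par (k + 2) r + M.par k r' + M.par 0 A) * M.par (k + 2) r
          + (M.par k r' + 1) * M.par 0 A) • (D.hsym k r r' A S X *
            (J.jet (.field (k + 2) r) 0 * J.dmul X (D.EL A)))) * J.jet (.anti k r') S := by
    intro S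
    have h1 := (J.hasParity_jet (.field (k + 2) r) 0).mul_comm (D.hsym_par k r r' A S X)
    have h2 := (J.hasParity_jet (.anti k r') S).mul_comm ((D.EL_par A).dmul X)
    rw [D.par_eq] at h1 h2
    rw [h1, mul_assoc, h2, smul_mul_smul_comm, gsign_add, smul_mul_assoc,
      mul_comm (Gen.parity _)]
    simp only [mul_assoc]
    rfl
  rw [finsum_congr hcomm, J.mk_finsum_mul_jet (.anti k r')
    (f := fun S => gsign ((M.par (k + 2) r + M.par k r' + M.par 0 A) * M.par (k + 2) r
          + (M.par k r' + 1) * M.par 0 A) • (D.hsym k r r' A S X *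
            (J.jet (.field (k + 2) r) 0 * J.dmul X (D.EL A))))]
  · congr 2
    rw [← smul_finsum, ← J.finsum_dmul_mul_right _ (hslice X), smul_finsum]
    exact finsum_congr fun S => by rw [JetCalculus.dmul_smul, smul_comm]
  · exact (hslice X).subset fun S hS h => hS (by dsimp only at h ⊢; rw [h, zero_mul, smul_zero])

/-- Removing the derivatives from the antifield applies the formal adjoint of Δ to `u`; nothing is
assumed about `u`. -/
theorem mk_u_mul_linPart (k : ℕ) (u : P) (r : M.R (k + 1)) : J.exact.mkQ (u * D.linPart k r)
    = ∑ r' : M.R k, J.exact.mkQ ((∑ᶠ S : MultiIdx M.n, J.dmul S u * J.eta (D.Δ k r r') S)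
        * J.jet (.anti k r') 0) := by
  rw [linPart, Finset.mul_sum, map_sum]
  refine Finset.sum_congr rfl fun r' _ => ?_
  have hf : (Function.support fun Λ => D.Δ k r r' Λ * J.jet (.anti k r') Λ).Finite :=
    (D.Δ_fin k r r').subset fun Λ hΛ h => hΛ (by dsimp only at h ⊢; rw [h, zero_mul])
  rw [mul_finsum' _ _ hf, ← J.finsum_dmul_mul_left u (D.Δ_fin k r r'),
    ← J.mk_finsum_mul_jet (.anti k r') (f := fun Λ => u * D.Δ k r r' Λ)]
  · simp only [mul_assoc]
  · exact (D.Δ_fin k r r').subset fun Λ hΛ h => hΛ (by dsimp only at h ⊢; rw [h, mul_zero])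

theorem symDensity_mem_exact (k : ℕ) (hgauge : D.GaugeCondition k) :
    D.symDensity k ∈ J.exact := by
  rw [← Submodule.ker_mkQ J.exact, LinearMap.mem_ker, symDensity, map_add, map_sum, map_sum]
  have h1 : ∑ r : M.R (k + 1), J.exact.mkQ (D.u (k + 1) r * D.linPart k r)
      = ∑ r' : M.R k, J.exact.mkQ (D.deltaBar (D.alpha k r') * J.jet (.anti k r') 0) := by
    simp only [mk_u_mul_linPart]
    rw [Finset.sum_comm]
    refine Finset.sum_congr rfl fun r' _ => ?_
    rw [← hgauge r', ← map_sum, ← Finset.sum_mul]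
    simp only [lderiv_u]
  rw [h1]
  simp only [map_sum, mk_ghost_term, deltaBar_alpha, neg_mul, Finset.sum_mul, map_neg,
    Finset.sum_neg_distrib]
  rw [Finset.sum_comm, add_neg_cancel]

theorem varDeriv_symDensity (k : ℕ) (r : M.R (k + 2)) :
    J.varDeriv (.field (k + 2) r) (D.symDensity k)
      = D.noetherLHS k r + D.deltaBar (D.quadPart k r) := by
  classical
  have hanti : ∀ (j : ℕ) (s : M.R j) S, J.Indep (.field (k + 2) r) (J.jet (.anti j s) S) :=
    fun j s S => JetCalculus.indep_jet (by simp) S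
  have hfield : ∀ (s : M.R (k + 2)) S, s ≠ r →
      J.Indep (.field (k + 2) r) (J.jet (.field (k + 2) s) S) :=
    fun s S hs => JetCalculus.indep_jet (by simpa using hs) S
  have hlin : ∀ s, J.Indep (.field (k + 2) r) (D.linPart k s) := fun s =>
    JetCalculus.Indep.sum fun r' => JetCalculus.Indep.finsum fun Λ =>
      (D.Δ_indep k s r' Λ _ (by simp)).mul (hanti k r' Λ)
  have heta : ∀ (s : M.R (k + 2)) r' Λ,
      J.Indep (.field (k + 2) r) (J.eta (D.Δ (k + 1) s r') Λ) := fun s r' Λ =>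
    JetCalculus.Indep.eta (fun S => D.Δ_indep (k + 1) s r' S _ (by simp)) Λ
  -- The undifferentiated ghost stands on the left, so the first term of the density is that ghost
  -- times δ̄ of the quadratic part, and its variational derivative is just the cofactor.
  have hghost : ∀ s : M.R (k + 2), (∑ r' : M.R k, ∑ A : M.R 0, ∑ᶠ X : MultiIdx M.n,
      ∑ᶠ S : MultiIdx M.n, J.jet (.field (k + 2) s) 0 * D.hsym k s r' A S X
        * J.jet (.anti k r') S * J.dmul X (D.EL A))
      = J.jet (.field (k + 2) s) 0 * D.deltaBar (D.quadPart k s) := by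
    intro s
    rw [deltaBar_quadPart, Finset.mul_sum]
    refine Finset.sum_congr rfl fun r' _ => ?_
    rw [Finset.mul_sum]
    refine Finset.sum_congr rfl fun A _ => ?_
    have := (LinearMap.mulLeft ℝ (J.jet (.field (k + 2) s) 0)).map_finsum_finsum
      (F := fun X S => D.hsym k s r' A S X * J.jet (.anti k r') S * J.dmul X (D.EL A))
      ((D.hsym_fin k s r' A).subset fun q hq h => hq (by
        dsimp only at h ⊢
        rw [h, zero_mul, zero_mul]))
    simp only [LinearMap.mulLeft_apply] at this
    rw [this]
    simp only [mul_assoc]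
  have hquad : ∀ s, J.Indep (.field (k + 2) r) (D.deltaBar (D.quadPart k s)) := by
    intro s
    rw [deltaBar_quadPart]
    exact JetCalculus.Indep.sum fun r' => JetCalculus.Indep.sum fun A =>
      JetCalculus.Indep.finsum fun X => JetCalculus.Indep.finsum fun S =>
        ((D.hsym_indep k s r' A S X _ (by simp)).mul (hanti k r' S)).mul
          ((D.EL_indep A _ (by simp)).dmul X)
  rw [symDensity, ← JetCalculus.varDerivLin_apply, map_add, map_sum, map_sum, add_comm]
  congr 1
  · refine Finset.sum_congr rfl fun r' _ => ?_
    rw [JetCalculus.varDerivLin_apply, u, Finset.sum_mul, ← JetCalculus.varDerivLin_apply, map_sum,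
      Finset.sum_eq_single r]
    · have hf := J.finite_support_eta (D.Δ_fin (k + 1) r r')
      -- η∘η = id is used here: Δ d_Λ(…) is rewritten as the alternating sum of d_Λ(η(Δ)^Λ …), which
      -- is the variational derivative of an expression linear in the ghost jets.
      rw [JetCalculus.varDerivLin_apply, finsum_mul', ← J.finsum_dmul_eta_mul _
        (D.Δ_fin (k + 1) r r')]
      · simp only [mul_assoc]
        exact JetCalculus.varDeriv_finsum_jet_mul (fun Λ => (heta r r' Λ).mul (hlin r'))
          (hf.subset fun Λ hΛ h => hΛ (by dsimp only; rw [h, zero_mul]))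
      · exact hf.subset fun Λ hΛ h => hΛ (by dsimp only; rw [h, mul_zero])
    · intro s _ hs
      exact JetCalculus.varDeriv_eq_zero ((JetCalculus.Indep.finsum fun Λ =>
        (hfield s Λ hs).mul (heta s r' Λ)).mul (hlin r'))
    · simp
  · rw [Finset.sum_eq_single r]
    · rw [hghost, JetCalculus.varDerivLin_apply, JetCalculus.varDeriv_jet_mul (hquad r),
        MultiIdx.len_zero, pow_zero, one_smul, JetCalculus.dmul_zero]
    · intro s _ hs
      rw [hghost]
      exact JetCalculus.varDeriv_eq_zero ((hfield s 0 hs).mul (hquad s))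
    · simp

theorem noether_identity (k : ℕ) (hgauge : D.GaugeCondition k) :
    D.symDensity k ∈ J.exact ∧
    ∀ r : M.R (k + 2),
      J.varDeriv (.field (k + 2) r) (D.symDensity k) = 0 ∧
      J.varDeriv (.field (k + 2) r) (D.symDensity k)
        = D.noetherLHS k r + D.deltaBar (D.quadPart k r) ∧
      D.noetherLHS k r = - D.deltaBar (D.quadPart k r) := by
  have h := D.symDensity_mem_exact k hgauge
  refine ⟨h, fun r => ?_⟩
  have h0 := J.varDeriv_eq_zero_of_mem_exact (.field (k + 2) r) h
  have h1 := D.varDeriv_symDensity k r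
  exact ⟨h0, h1, eq_neg_of_add_eq_zero_left (h1.symm.trans h0)⟩

end NoetherOps

/-! ### Transfer from the abstract calculus to the chart. -/

namespace FieldChart

variable (M : FieldChart)

/-- The jet calculus of the graded functions on a chart. -/
def calculus : JetCalculus M.Gen M.n M.Alg where
  par := Gen.parity
  tau := M.tau
  tau_tau := tau_tau
  mul_add_tau := mul_add_tau
  mul_sub_tau := mul_sub_tau
  jet := jet
  xderiv := xderiv
  lderiv := lderiv
  tau_jet := hasParity_jet
  tau_xderiv := tau_xderiv
  tau_lderiv := tau_lderiv
  xderiv_mul := xderiv_mul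
  lderiv_mul := lderiv_mul
  xderiv_comm := xderiv_comm
  lderiv_xderiv := lderiv_xderiv
  lderiv_comm := lderiv_comm
  xderiv_jet := xderiv_jet
  lderiv_jet_self v Λ := by rw [lderiv_jet, if_pos ⟨rfl, rfl⟩]
  lderiv_jet_of_ne v w Λ S h := by rw [lderiv_jet, if_neg fun h' => h (Prod.ext h'.1 h'.2)]
  finite_lderiv_ne_zero := finite_lderiv_ne_zero

theorem calculus_indep {v : M.Gen} (hv : ∀ A, v ≠ .field 0 A) {f : M.Alg} (hf : f ∈ M.fieldAlg) :
    M.calculus.Indep v f := fun Λ => lderiv_eq_zero_of_mem_fieldAlg hv Λ hf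

theorem calculus_rderiv (v : M.Gen) (Λ : MultiIdx M.n) (f : M.Alg) :
    M.calculus.rderiv v Λ f = rderiv v Λ f :=
  ((M.calculus.tauPow_apply v.parity (lderiv v Λ f)).trans (rderiv_eq v Λ f).symm)

end FieldChart

namespace NoetherData

open FieldChart

variable {M : FieldChart} (D : NoetherData M)

/-- The Noether operators of `D` in the jet calculus of the chart. -/
def toOps : NoetherOps M M.calculus where
  par_eq _ := rfl
  EL := D.EL
  EL_par A := JetCalculus.HasParity.varDeriv (J := M.calculus) D.L_par (.field 0 A)
  EL_indep A _ hv := (M.calculus_indep hv D.L_mem).varDeriv (.field 0 A)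
  Δ := D.Δ
  Δ_fin := D.Δ_fin
  Δ_indep k r r' Λ _ hv := M.calculus_indep hv (D.Δ_mem k r r' Λ)
  h := D.h
  h_par := D.h_par
  h_fin := D.h_fin
  h_indep k r r' A S X _ hv := M.calculus_indep hv (D.h_mem k r r' A S X)

theorem toOps_deltaBar (f : M.Alg) : D.toOps.deltaBar f = D.deltaBar f :=
  Finset.sum_congr rfl fun A _ => finsum_congr fun Λ =>
    congrArg (· * dmul Λ (D.EL A)) (M.calculus_rderiv (.anti 0 A) Λ f)

theorem toOps_hsym : ∀ k r r' A S X, D.toOps.hsym k r r' A S X = D.hsym k r r' A S X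
  | 0, _, _, _, _, _ => rfl
  | _ + 1, _, _, _, _, _ => rfl

theorem toOps_alpha (k : ℕ) (r' : M.R k) : D.toOps.alpha k r' = D.alpha k r' := by
  have h : D.toOps.hsym = D.hsym := by
    funext k r r' A S X
    exact D.toOps_hsym k r r' A S X
  unfold NoetherOps.alpha
  rw [h]
  rfl

theorem toOps_symDensity (k : ℕ) : D.toOps.symDensity k = D.symDensity k := by
  have h : D.toOps.hsym = D.hsym := by
    funext k r r' A S X
    exact D.toOps_hsym k r r' A S X
  unfold NoetherOps.symDensity
  rw [h]
  rfl

theorem toOps_gaugeCondition (k : ℕ) (h : D.GaugeCondition k) : D.toOps.GaugeCondition k := by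
  intro r'
  rw [toOps_alpha, toOps_deltaBar]
  exact h r'

theorem toOps_quadPart (k : ℕ) (r : M.R (k + 2)) : D.toOps.quadPart k r = D.quadPart k r := rfl

theorem toOps_noetherLHS (k : ℕ) (r : M.R (k + 2)) : D.toOps.noetherLHS k r = D.noetherLHS k r :=
  rfl

end NoetherData

end

theorem theorem826 (M : FieldChart) (D : NoetherData M) (k : ℕ) (hk : k + 1 ≤ M.N)
    (hgauge : D.GaugeCondition k) :
    FieldChart.IsHExact (D.symDensity k) ∧
    ∀ r : M.R (k + 2),
      FieldChart.varDeriv (.field (k + 2) r) (D.symDensity k) = 0 ∧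
      FieldChart.varDeriv (.field (k + 2) r) (D.symDensity k)
        = D.noetherLHS k r + D.deltaBar (D.quadPart k r) ∧
      D.noetherLHS k r = - D.deltaBar (D.quadPart k r) := by
  have h := D.toOps.noether_identity k (D.toOps_gaugeCondition k hgauge)
  rw [NoetherData.toOps_symDensity] at h
  refine ⟨h.1, fun r => ?_⟩
  have hr := h.2 r
  rw [NoetherData.toOps_deltaBar, NoetherData.toOps_noetherLHS, NoetherData.toOps_quadPart] at hr
  exact hr
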